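/- Let $\sigma(z)=\max\{0,z\}$. A ReLU network with $d$ inputs is a finite acyclic directed graph whose nodes each compute $z\mapsto\sigma(a^\top z+b)$, where $z$ collects the inputs of the network and the outputs of other nodes that have an edge into this node, and $a$, $b$ are real parameters of the node; in addition there is one output node, which computes an affine function $a^\top z+b$ of the outputs of the ReLU nodes. (A network whose output is a ReLU node is the special case in which the output node copies that node.) The size of the network is its number of nodes. There is an absolute constant $C>0$ such that the following two statements hold. 1. Let $\epsilon\in(0,1]$, let $k,d,r,s\ge 0$ be integers and let $A\ge 1$. Let $p,q$ be real polynomials in $d$ variables of total degree at most $r$, each with at most $s$ monomials and with all coefficients in $[-A,A]$, such that $p(x)\in[-1,1]$ and $q(x)\in[2^{-k},1]$ for all $x\in[0,1]^d$. Then there is a ReLU network computing a function $f$, of size at most $$C\Big((k+1)^7\ln(2/\epsilon)^3+\min\big\{s\,r\,(k+1)\ln(Asr/\epsilon),\ s\,d\,(k+1)^2\ln(Adsr/\epsilon)^2\big\}\Big)$$ (the minimum is read as $0$ if $rd=0$), such that $\sup_{x\in[0,1]^d}|f(x)-p(x)/q(x)|\le\epsilon$. In particular, if all coefficients lie in $[-1,1]$,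 $k\ge1$ and $\epsilon\le 1/2$, then the size is $O\big(k^7\ln(1/\epsilon)^3+\min\{srk\ln(sr/\epsilon),\,sdk^2\ln(dsr/\epsilon)^2\}\big)$. 2. Let $\epsilon\in(0,1]$, and let $f:[-1,1]^d\to\mathbb R$ be computed by a ReLU network whose ReLU nodes are arranged in at most $k$ layers with at most $m$ nodes each, every node using only inputs of the network and outputs of nodes in earlier layers, and where the parameters $(a,b)$ of every node, the output node included, satisfy $\|a\|_1+|b|\le 1$. Then there are real polynomials $P,Q$ in $d$ variables with $Q>0$ on $\mathbb R^d$ and $$\max\{\deg P,\deg Q\}\le\big(C\,m\,\ln(k/\epsilon)^2\big)^k$$ (for $k=0$ the right side is read as $1$) such that $\sup_{x\in[-1,1]^d}|f(x)-P(x)/Q(x)|\le\epsilon$. -/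

import Mathlib

open scoped BigOperators

noncomputable section

/-- The ReLU activation `z ↦ max {0, z}`. -/
def relu (z : ℝ) : ℝ := max 0 z

/-- A ReLU network with `d` real inputs: an acyclic directed graph on `N` ReLU nodes, listed in a
topological order, together with one affine output node.  Node `i` computes `relu (aᵀ z + b)`, where
`z` consists of the inputs and of the outputs of earlier nodes (a weight `0` means that there is
no edge), `a` consists of `inW i` and `nodeW i`, and `b` is `bias i`. -/
structure ReLUNet (d N : ℕ) where
  /-- weights of the edges from the inputs -/
  inW : Fin N → Fin d → ℝ
  /-- `nodeW i j` is the weight of the edge from node `j` to node `i` -/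
  nodeW : Fin N → Fin N → ℝ
  /-- biases -/
  bias : Fin N → ℝ
  /-- edges go from earlier nodes to later nodes -/
  acyclic : ∀ i j : Fin N, i ≤ j → nodeW i j = 0
  /-- weights of the output node -/
  outW : Fin N → ℝ
  /-- bias of the output node -/
  outB : ℝ

namespace ReLUNet

variable {d N : ℕ}

/-- The value computed by node `i` on the input `x`. -/
def val (net : ReLUNet d N) (x : Fin d → ℝ) (i : Fin N) : ℝ :=
  relu ((∑ l : Fin d, net.inW i l * x l)
    + (∑ j : Fin i.val, net.nodeW i ⟨j.val, j.isLt.trans i.isLt⟩ *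
        val net x ⟨j.val, j.isLt.trans i.isLt⟩)
    + net.bias i)
termination_by i.val
decreasing_by exact j.isLt

/-- The function computed by the network: the value of its affine output node. -/
def eval (net : ReLUNet d N) (x : Fin d → ℝ) : ℝ :=
  (∑ i : Fin N, net.outW i * net.val x i) + net.outB

/-- The number of nodes, the output node included. -/
def size (_net : ReLUNet d N) : ℕ := N + 1

/-- Every node, the output node included, has parameters `(a, b)` with `‖a‖₁ + |b| ≤ 1`. -/
def Normalized (net : ReLUNet d N) : Prop :=
  (∀ i : Fin N, (∑ l : Fin d, |net.inW i l|) + (∑ j : Fin N, |net.nodeW i j|)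
      + |net.bias i| ≤ 1) ∧
    (∑ i : Fin N, |net.outW i|) + |net.outB| ≤ 1

/-- The ReLU nodes can be arranged in (at most) `k` layers with at most `m` nodes each, where a
node only takes inputs of the network and outputs of nodes in strictly earlier layers. -/
def HasLayers (net : ReLUNet d N) (k m : ℕ) : Prop :=
  ∃ layer : Fin N → Fin k,
    (∀ i j : Fin N, net.nodeW i j ≠ 0 → layer j < layer i) ∧
    ∀ l : Fin k, (Finset.univ.filter fun i => layer i = l).card ≤ m

/-- The defining recursion of a network, with the sum taken over all nodes. -/
theorem val_eq (net : ReLUNet d N) (x : Fin d → ℝ) (i : Fin N) :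
    net.val x i = relu ((∑ l : Fin d, net.inW i l * x l)
      + (∑ j : Fin N, net.nodeW i j * net.val x j) + net.bias i) := by
  have key : (∑ j : Fin N, net.nodeW i j * net.val x j)
      = ∑ j : Fin i.val, net.nodeW i ⟨j.val, j.isLt.trans i.isLt⟩ *
        net.val x ⟨j.val, j.isLt.trans i.isLt⟩ := by
    symm
    refine Finset.sum_of_injOn (fun j : Fin i.val => (⟨j.val, j.isLt.trans i.isLt⟩ : Fin N))
      ?_ ?_ ?_ ?_
    · intro a _ b _ h
      simpa [Fin.ext_iff] using h
    · intro a _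
      simp
    · intro j _ hj
      have hij : i ≤ j := by
        by_contra hlt
        exact hj ⟨⟨j.val, not_le.mp hlt⟩, by simp, rfl⟩
      simp [net.acyclic i j hij]
    · intro a _
      rfl
  rw [val, key]

end ReLUNet

end

/-! Networks for p/q. Linear combinations cost no nodes, so a construction is recorded as a growing
space of functions, and only the adjoined ReLU functions are counted (`ReluExt`). Composing with the
tent map gives squares up to 4^(-m) with m nodes (`exists_approx_sq`). Polarization turns squares
into products, and clipping each product to [0, 1] makes errors add up instead of multiplying
(`UnitApprox.exists_mul`). Monomials are built factor by factor or by repeated squaring, which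
yields the two terms of the minimum. For the division put z = 1 - q. The first 2^t terms of the
geometric series for 1/q factor as the product of the 1 + z^(2^j), j < t, so they cost only 2t
multiplications (`exists_approx_div`). Since q ≥ 2^(-k), about 2k + ln(2/ε) factors suffice. The
division then costs O(((k+1) ln(2/ε))^2) nodes, which the stated term of degree 7 in k + 1 and 3 in
the logarithm dominates.

Rational functions for networks. A Newman-type quotient of degree r = O(ln(1/δ)^2) approximates ReLU
within δ on [-2, 2] (`exists_rational_approx_relu`) and replaces ReLU in every node. Normalization
keeps all arguments in [-1, 1], and with the 1-Lipschitz property each layer adds only δ to the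
error, so δ = ε/k works. The degree is controlled by giving all nodes of the first t layers one
common denominator: affine combinations then leave the degree alone, and a layer of at most m nodes
multiplies it by at most 1 + m r (`exists_fractions`). -/

/-! ### Networks as spaces of functions -/

/-- `ReluExt n V W`: the space of functions `W` is obtained from `V` by adjoining, one after the
other, at most `n` functions `relu ∘ f` with `f` in the space obtained so far. -/
inductive ReluExt {X : Type*} : ℕ → Submodule ℝ (X → ℝ) → Submodule ℝ (X → ℝ) → Prop
  | refl (n : ℕ) (V : Submodule ℝ (X → ℝ)) : ReluExt n V V
  | step {n : ℕ} {V W : Submodule ℝ (X → ℝ)} {f : X → ℝ} (h : ReluExt n V W) (hf : f ∈ W) :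
      ReluExt (n + 1) V (W ⊔ Submodule.span ℝ {fun x => relu (f x)})

namespace ReluExt

variable {X : Type*} {n m : ℕ} {U V W : Submodule ℝ (X → ℝ)}

theorem le (h : ReluExt n V W) : V ≤ W := by
  induction h with
  | refl => exact le_rfl
  | step h hf ih => exact ih.trans le_sup_left

theorem mono (h : ReluExt n V W) (hnm : n ≤ m) : ReluExt m V W := by
  induction h generalizing m with
  | refl => exact refl _ _
  | step h hf ih =>
    obtain ⟨m, rfl⟩ := Nat.exists_eq_add_of_le' (Nat.one_le_of_lt hnm)
    exact (ih (by omega)).step hf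

theorem trans (h : ReluExt n U V) (h' : ReluExt m V W) : ReluExt (n + m) U W := by
  induction h' with
  | refl => exact h.mono (by omega)
  | step _ hf ih => exact (ih h).step hf

theorem exists_relu (V : Submodule ℝ (X → ℝ)) {f : X → ℝ} (hf : f ∈ V) :
    ∃ W, ReluExt 1 V W ∧ (fun x => relu (f x)) ∈ W :=
  ⟨_, (refl 0 V).step hf,
    Submodule.mem_sup_right (Submodule.mem_span_singleton_self _)⟩

end ReluExt

/-- The affine functions on `ℝ^d`. -/
def affineFns (d : ℕ) : Submodule ℝ ((Fin d → ℝ) → ℝ) :=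
  Submodule.span ℝ (insert (fun _ => 1) (Set.range fun (l : Fin d) (x : Fin d → ℝ) => x l))

theorem one_mem_affineFns (d : ℕ) : (fun _ => 1) ∈ affineFns d :=
  Submodule.subset_span (Set.mem_insert _ _)

theorem coord_mem_affineFns {d : ℕ} (l : Fin d) : (fun x => x l) ∈ affineFns d :=
  Submodule.subset_span (Set.mem_insert_of_mem _ ⟨l, rfl⟩)

namespace ReLUNet

variable {d N : ℕ}

/-- The space spanned by the constants, the inputs and the node values of a network. -/
def fns (net : ReLUNet d N) : Submodule ℝ ((Fin d → ℝ) → ℝ) where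
  carrier := {f | ∃ (c : Fin d → ℝ) (a : Fin N → ℝ) (b : ℝ), ∀ x,
    f x = (∑ l, c l * x l) + (∑ i, a i * net.val x i) + b}
  zero_mem' := ⟨0, 0, 0, by simp⟩
  add_mem' := by
    rintro f g ⟨c, a, b, h⟩ ⟨c', a', b', h'⟩
    refine ⟨c + c', a + a', b + b', fun x => ?_⟩
    simp only [Pi.add_apply, h, h', add_mul, Finset.sum_add_distrib]
    ring
  smul_mem' := by
    rintro t f ⟨c, a, b, h⟩
    refine ⟨t • c, t • a, t * b, fun x => ?_⟩
    simp only [Pi.smul_apply, smul_eq_mul, h, mul_assoc, ← Finset.mul_sum]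
    ring

theorem affineFns_le_fns (net : ReLUNet d N) : affineFns d ≤ net.fns := by
  refine Submodule.span_le.2 ?_
  rintro f (rfl | ⟨l, rfl⟩)
  · exact ⟨0, 0, 1, by simp⟩
  · exact ⟨Pi.single l 1, 0, 0, by simp [Pi.single_apply]⟩

/-- Append a node to a network. -/
def snoc (net : ReLUNet d N) (c : Fin d → ℝ) (a : Fin N → ℝ) (b : ℝ) : ReLUNet d (N + 1) where
  inW := Fin.snoc (α := fun _ => Fin d → ℝ) net.inW c
  nodeW := Fin.snoc (α := fun _ => Fin (N + 1) → ℝ)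
    (fun i => Fin.snoc (α := fun _ => ℝ) (net.nodeW i) 0) (Fin.snoc (α := fun _ => ℝ) a 0)
  bias := Fin.snoc (α := fun _ => ℝ) net.bias b
  acyclic := by
    intro i j hij
    induction j using Fin.lastCases with
    | last => induction i using Fin.lastCases <;> simp
    | cast j =>
      induction i using Fin.lastCases with
      | last => exact absurd hij (not_le.2 (Fin.castSucc_lt_last j))
      | cast i => simpa using net.acyclic i j (by simpa using hij)
  outW := 0
  outB := 0

theorem snoc_val_castSucc (net : ReLUNet d N) (c : Fin d → ℝ) (a : Fin N → ℝ) (b : ℝ)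
    (x : Fin d → ℝ) (i : Fin N) : (net.snoc c a b).val x i.castSucc = net.val x i := by
  induction i using WellFoundedLT.induction with
  | ind i ih =>
    rw [val_eq, val_eq, Fin.sum_univ_castSucc]
    have key : ∀ j : Fin N, (net.snoc c a b).nodeW i.castSucc j.castSucc
        * (net.snoc c a b).val x j.castSucc = net.nodeW i j * net.val x j := by
      intro j
      rcases lt_or_ge j i with hj | hj
      · rw [ih j hj]
        simp [snoc]
      · simp [snoc, net.acyclic i j hj]
    simp only [key]
    simp [snoc]

theorem snoc_val_last (net : ReLUNet d N) (c : Fin d → ℝ) (a : Fin N → ℝ) (b : ℝ)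
    (x : Fin d → ℝ) : (net.snoc c a b).val x (Fin.last N)
      = relu ((∑ l, c l * x l) + (∑ i, a i * net.val x i) + b) := by
  rw [val_eq, Fin.sum_univ_castSucc]
  simp only [snoc_val_castSucc]
  simp [snoc]

theorem fns_le_snoc_fns (net : ReLUNet d N) (c : Fin d → ℝ) (a : Fin N → ℝ) (b : ℝ) :
    net.fns ≤ (net.snoc c a b).fns := by
  rintro f ⟨c', a', b', h⟩
  refine ⟨c', Fin.snoc (α := fun _ => ℝ) a' 0, b', fun x => ?_⟩
  rw [h, Fin.sum_univ_castSucc]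
  simp [snoc_val_castSucc]

theorem val_mem_fns (net : ReLUNet d N) (i : Fin N) : (fun x => net.val x i) ∈ net.fns :=
  ⟨0, Pi.single i 1, 0, by simp [Pi.single_apply]⟩

end ReLUNet

theorem ReluExt.exists_net {d n : ℕ} {W : Submodule ℝ ((Fin d → ℝ) → ℝ)}
    (h : ReluExt n (affineFns d) W) : ∃ N ≤ n, ∃ net : ReLUNet d N, W ≤ net.fns := by
  generalize hV : affineFns d = V at h
  induction h with
  | refl n V =>
    subst hV
    exact ⟨0, Nat.zero_le _, ⟨0, 0, 0, fun i => i.elim0, 0, 0⟩, ReLUNet.affineFns_le_fns _⟩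
  | @step n V W f h hf ih =>
    obtain ⟨N, hN, net, hW⟩ := ih hV
    obtain ⟨c, a, b, hfx⟩ := hW hf
    refine ⟨N + 1, by omega, net.snoc c a b, sup_le (hW.trans (net.fns_le_snoc_fns c a b)) ?_⟩
    rw [Submodule.span_singleton_le_iff_mem]
    convert (net.snoc c a b).val_mem_fns (Fin.last N) using 2 with x
    rw [ReLUNet.snoc_val_last, hfx]

theorem relu_sub_relu_neg (z : ℝ) : relu z - relu (-z) = z := by
  unfold relu
  rcases le_total 0 z with h | h <;> simp [h]

/-- A function in an extension by `n` nodes is the output of a network of size `n + 3`. -/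
theorem ReluExt.exists_eval_eq {d n : ℕ} {W : Submodule ℝ ((Fin d → ℝ) → ℝ)}
    (h : ReluExt n (affineFns d) W) {f : (Fin d → ℝ) → ℝ} (hf : f ∈ W) :
    ∃ (N : ℕ) (net : ReLUNet d N), net.size ≤ n + 3 ∧ ∀ x, net.eval x = f x := by
  obtain ⟨N, hN, net, hW⟩ := h.exists_net
  obtain ⟨c, a, b, hfx⟩ := hW hf
  -- The output node reads ReLU nodes only, while `f` may involve the inputs directly. Two more
  -- nodes give f = relu f - relu (-f); with the output node this is the 3 in the size.
  let net₁ := net.snoc c a b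
  let net₂ := net₁.snoc (-c) (Fin.snoc (α := fun _ => ℝ) (-a) 0) (-b)
  refine ⟨N + 2, { net₂ with
    outW := Fin.snoc (α := fun _ => ℝ) (Fin.snoc (α := fun _ => ℝ) 0 1) (-1)
    outB := 0 }, by simp only [ReLUNet.size]; omega, fun x => ?_⟩
  -- Node values do not depend on the output weights, but `val` recurses through the whole
  -- structure, so an induction is needed.
  have hv : ∀ (w : Fin (N + 2) → ℝ) (t : ℝ) (i : Fin (N + 2)),
      ({ net₂ with outW := w, outB := t } : ReLUNet d (N + 2)).val x i = net₂.val x i := by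
    intro w t i
    induction i using WellFoundedLT.induction with
    | ind i ih =>
      rw [ReLUNet.val, ReLUNet.val]
      congr 3
      exact Finset.sum_congr rfl fun j _ => by rw [ih _ (by exact j.isLt)]
  simp only [ReLUNet.eval, hv]
  rw [Fin.sum_univ_castSucc, Fin.sum_univ_castSucc]
  simp only [net₂, net₁, ReLUNet.snoc_val_last, ReLUNet.snoc_val_castSucc]
  simp only [Fin.snoc_castSucc, Fin.snoc_last, Pi.zero_apply, zero_mul, Finset.sum_const_zero,
    Fin.sum_univ_castSucc, ReLUNet.snoc_val_castSucc, Pi.neg_apply, neg_mul,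
    Finset.sum_neg_distrib, hfx]
  have h := relu_sub_relu_neg ((∑ l, c l * x l) + (∑ i, a i * net.val x i) + b)
  rw [neg_add, neg_add] at h
  simp only [zero_add, add_zero, one_mul]
  linarith

/-! ### Approximate arithmetic -/

/-- `f` maps `S` to `[0, 1]` and is, up to `e` on `S`, a `[0, 1]`-valued function of `V`. -/
def UnitApprox {X : Type*} (S : Set X) (V : Submodule ℝ (X → ℝ)) (f : X → ℝ) (e : ℝ) : Prop :=
  (∀ x ∈ S, f x ∈ Set.Icc (0 : ℝ) 1) ∧
    ∃ h ∈ V, ∀ x ∈ S, h x ∈ Set.Icc (0 : ℝ) 1 ∧ |h x - f x| ≤ e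

section gadgets

variable {X : Type*} {S : Set X} {V W : Submodule ℝ (X → ℝ)} {f g : X → ℝ} {e e' : ℝ}

theorem UnitApprox.mono (h : UnitApprox S V f e) (hVW : V ≤ W) (he : e ≤ e') :
    UnitApprox S W f e' := by
  obtain ⟨hf, h, hV, hh⟩ := h
  exact ⟨hf, h, hVW hV, fun x hx => ⟨(hh x hx).1, (hh x hx).2.trans he⟩⟩

theorem UnitApprox.one (h1 : (fun _ => 1) ∈ V) : UnitApprox S V (fun _ => 1) 0 :=
  ⟨fun _ _ => by simp, _, h1, by simp⟩

theorem UnitApprox.of_mem (hf : f ∈ V) (h : ∀ x ∈ S, f x ∈ Set.Icc (0 : ℝ) 1) :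
    UnitApprox S V f 0 :=
  ⟨h, f, hf, fun x hx => ⟨h x hx, by simp⟩⟩

theorem const_mem (h1 : (fun _ => 1) ∈ V) (c : ℝ) : (fun _ => c) ∈ V := by
  convert V.smul_mem c h1 using 1
  ext; simp

/-- Affine combinations of two functions. -/
theorem lin_mem (h1 : (fun _ => 1) ∈ V) (hf : f ∈ V) (hg : g ∈ V) (a b c : ℝ) :
    (fun x => a * f x + b * g x + c) ∈ V :=
  V.add_mem (V.add_mem (V.smul_mem a hf) (V.smul_mem b hg)) (const_mem h1 c)

/-- For the tent map T y = 2 y - 4 relu (y - 1/2) on [0, 1] one has y² = y - T y / 2 + (T y)² / 4.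
Each use costs one node and divides the remaining error by 4, starting from the trivial
approximation of a square by 0. -/
theorem exists_approx_sq (h1 : (fun _ => 1) ∈ V) (m : ℕ) (hf : f ∈ V)
    (hS : ∀ x ∈ S, f x ∈ Set.Icc (0 : ℝ) 1) :
    ∃ W, ReluExt m V W ∧ ∃ h ∈ W, ∀ x ∈ S, |h x - f x ^ 2| ≤ (4 ^ m : ℝ)⁻¹ := by
  induction m generalizing V f with
  | zero =>
    refine ⟨V, .refl _ _, 0, V.zero_mem, fun x hx => ?_⟩
    obtain ⟨h0, h1⟩ := hS x hx
    simp only [Pi.zero_apply, zero_sub, abs_neg, pow_zero, inv_one]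
    rw [abs_of_nonneg (by positivity)]
    nlinarith
  | succ m ih =>
    obtain ⟨W₁, hW₁, hr⟩ := ReluExt.exists_relu V (lin_mem h1 hf hf 1 0 (-(1 / 2)))
    have h1' := hW₁.le h1
    have hf' := hW₁.le hf
    have hT := lin_mem h1' hf' hr 2 (-4) 0
    have key : ∀ x ∈ S, (2 * f x + -4 * relu (1 * f x + 0 * f x + -(1 / 2)) + 0 ∈
        Set.Icc (0 : ℝ) 1) ∧ f x ^ 2 = f x
          - (2 * f x + -4 * relu (1 * f x + 0 * f x + -(1 / 2)) + 0) / 2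
          + (2 * f x + -4 * relu (1 * f x + 0 * f x + -(1 / 2)) + 0) ^ 2 / 4 := by
      intro x hx
      obtain ⟨h0, h1⟩ := hS x hx
      unfold relu
      rcases le_total (f x) (1 / 2) with h | h
      · rw [max_eq_left (by linarith)]
        exact ⟨⟨by linarith, by linarith⟩, by ring⟩
      · rw [max_eq_right (by linarith)]
        exact ⟨⟨by linarith, by linarith⟩, by ring⟩
    obtain ⟨W, hW, h, hh, herr⟩ := ih h1' hT fun x hx => (key x hx).1
    refine ⟨W, (hW₁.trans hW).mono (by omega), _,
      lin_mem (hW.le h1') (lin_mem (hW.le h1') (hW.le hf') (hW.le hT) 1 (-(1 / 2)) 0) hh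
        1 (1 / 4) 0, fun x hx => ?_⟩
    have h2 := herr x hx
    rw [(key x hx).2, pow_succ (4 : ℝ), mul_inv]
    rw [abs_le] at h2 ⊢
    constructor <;> linarith [h2.1, h2.2]

/-- Clipping to `[0, 1]`. -/
theorem exists_unitApprox_of_approx (h1 : (fun _ => 1) ∈ V) {h : X → ℝ} (hh : h ∈ V)
    (hS : ∀ x ∈ S, f x ∈ Set.Icc (0 : ℝ) 1) (herr : ∀ x ∈ S, |h x - f x| ≤ e) :
    ∃ W, ReluExt 2 V W ∧ UnitApprox S W f e := by
  obtain ⟨W₁, hW₁, hr₁⟩ := ReluExt.exists_relu V hh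
  obtain ⟨W₂, hW₂, hr₂⟩ := ReluExt.exists_relu W₁ (hW₁.le (lin_mem h1 hh hh 1 0 (-1)))
  -- The clipped function is relu h - relu (h - 1); clipping cannot increase the distance to a
  -- target in [0, 1].
  refine ⟨W₂, hW₁.trans hW₂, hS, _, lin_mem (hW₂.le (hW₁.le h1)) (hW₂.le hr₁) hr₂ 1 (-1) 0,
    fun x hx => ?_⟩
  obtain ⟨h0, h1⟩ := hS x hx
  have h2 := abs_le.1 (herr x hx)
  have he : 0 ≤ e := (abs_nonneg _).trans (herr x hx)
  simp only [abs_le, Set.mem_Icc]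
  unfold relu
  rcases le_total 0 (h x) with ha | ha <;>
  rcases le_total 0 (1 * h x + 0 * h x + -1) with hb | hb <;>
  simp only [ha, hb, max_eq_left, max_eq_right] <;>
  refine ⟨⟨?_, ?_⟩, ?_, ?_⟩ <;> linarith [h2.1, h2.2]

/-- Polarization: u v = ((u + v)/2)² - (|u - v|/2)², with both bases in [0, 1]. The node count is
one for the absolute value, m for each square and two for clipping. The errors of the factors just
add because all functions are bounded by 1. -/
theorem UnitApprox.exists_mul (h1 : (fun _ => 1) ∈ V) (m : ℕ) (hf : UnitApprox S V f e)
    (hg : UnitApprox S V g e') : ∃ W, ReluExt (2 * m + 3) V W ∧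
      UnitApprox S W (fun x => f x * g x) (e + e' + 2 * (4 ^ m : ℝ)⁻¹) := by
  obtain ⟨hf, u, hu, hfu⟩ := hf
  obtain ⟨hg, v, hv, hgv⟩ := hg
  obtain ⟨W₁, hW₁, hr⟩ := ReluExt.exists_relu V (lin_mem h1 hu hv 1 (-1) 0)
  have hu₁ := hW₁.le hu
  have hv₁ := hW₁.le hv
  have h1₁ := hW₁.le h1
  have ha := lin_mem h1₁ (lin_mem h1₁ hu₁ hv₁ (-(1 / 2)) (1 / 2) 0) hr 1 1 0
  have habs : ∀ x, 1 * (-(1 / 2) * u x + 1 / 2 * v x + 0)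
      + 1 * relu (1 * u x + -1 * v x + 0) + 0 = |u x - v x| / 2 := by
    intro x
    unfold relu
    rcases le_total (v x) (u x) with h | h
    · rw [max_eq_right (by linarith), abs_of_nonneg (by linarith)]; ring
    · rw [max_eq_left (by linarith), abs_of_nonpos (by linarith)]; ring
  simp only [habs] at ha
  obtain ⟨W₂, hW₂, s, hs, hsx⟩ := exists_approx_sq (S := S) h1₁ m
    (lin_mem h1₁ hu₁ hv₁ (1 / 2) (1 / 2) 0) (fun x hx => by
      obtain ⟨⟨h0, h1⟩, -⟩ := hfu x hx
      obtain ⟨⟨h0', h1'⟩, -⟩ := hgv x hx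
      constructor <;> linarith)
  have h1₂ := hW₂.le h1₁
  obtain ⟨W₃, hW₃, t, ht, htx⟩ := exists_approx_sq (S := S) h1₂ m (hW₂.le ha) (fun x hx => by
      obtain ⟨⟨h0, h1⟩, -⟩ := hfu x hx
      obtain ⟨⟨h0', h1'⟩, -⟩ := hgv x hx
      have : |u x - v x| ≤ 1 := abs_le.2 ⟨by linarith, by linarith⟩
      constructor <;> linarith [abs_nonneg (u x - v x)])
  have h1₃ := hW₃.le h1₂
  obtain ⟨W₄, hW₄, hA⟩ := exists_unitApprox_of_approx (S := S) (f := fun x => f x * g x)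
    (e := e + e' + 2 * (4 ^ m : ℝ)⁻¹) h1₃ (lin_mem h1₃ (hW₃.le hs) ht 1 (-1) 0)
    (fun x hx => by
      obtain ⟨h0, h1⟩ := hf x hx
      obtain ⟨h0', h1'⟩ := hg x hx
      exact ⟨mul_nonneg h0 h0', mul_le_one₀ h1 h0' h1'⟩)
    (fun x hx => by
      obtain ⟨h0, h1⟩ := hf x hx
      obtain ⟨⟨h0', h1'⟩, hvx⟩ := hgv x hx
      have hux := (hfu x hx).2
      have hs := hsx x hx
      have ht := htx x hx
      have e1 : |(u x - f x) * v x| ≤ e := by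
        rw [abs_mul, abs_of_nonneg h0']
        nlinarith [abs_nonneg (u x - f x)]
      have e2 : |(v x - g x) * f x| ≤ e' := by
        rw [abs_mul, abs_of_nonneg h0]
        nlinarith [abs_nonneg (v x - g x)]
      have hq : (1 / 2 * u x + 1 / 2 * v x + 0) ^ 2 - (|u x - v x| / 2) ^ 2 = u x * v x := by
        rw [div_pow, sq_abs]; ring
      rw [abs_le] at *
      constructor <;> nlinarith)
  exact ⟨W₄, (((hW₁.trans hW₂).trans hW₃).trans hW₄).mono (by omega), hA⟩

/-- Products of finitely many functions. -/
theorem UnitApprox.exists_multiset_prod (h1 : (fun _ => 1) ∈ V) (m : ℕ) (M : Multiset (X → ℝ))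
    (hM : ∀ f ∈ M, UnitApprox S V f e) : ∃ W, ReluExt (M.card * (2 * m + 3)) V W ∧
      UnitApprox S W (fun x => (M.map fun f => f x).prod) (M.card * (e + 2 * (4 ^ m : ℝ)⁻¹)) := by
  induction M using Multiset.induction with
  | empty => exact ⟨V, .refl _ _, by simpa using UnitApprox.one h1⟩
  | cons f M ih =>
    obtain ⟨W, hW, hA⟩ := ih fun f hf => hM f (Multiset.mem_cons_of_mem hf)
    obtain ⟨W', hW', hA'⟩ := ((hM f (Multiset.mem_cons_self _ _)).mono hW.le le_rfl).exists_mul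
      (hW.le h1) m hA
    refine ⟨W', (hW.trans hW').mono (by simp [add_mul]), ?_⟩
    simp only [Multiset.map_cons, Multiset.prod_cons]
    refine hA'.mono le_rfl (le_of_eq ?_)
    push_cast [Multiset.card_cons]
    ring

/-- Powers, by repeated squaring. -/
theorem UnitApprox.exists_pow (h1 : (fun _ => 1) ∈ V) (m : ℕ) (hf : UnitApprox S V f e) {n : ℕ}
    (hn : n ≠ 0) : ∃ W, ReluExt (2 * Nat.log 2 n * (2 * m + 3)) V W ∧
      UnitApprox S W (fun x => f x ^ n)
        (n * (e + 3 * (2 * (4 ^ m : ℝ)⁻¹)) - 2 * (4 ^ m : ℝ)⁻¹) := by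
  have hδ : (0 : ℝ) < 2 * (4 ^ m : ℝ)⁻¹ := by positivity
  set δ := 2 * (4 ^ m : ℝ)⁻¹
  -- A squaring changes an error a into 2a + δ. Subtracting δ in the claimed bound turns this into
  -- exact doubling, so the induction closes.
  induction n using Nat.strong_induction_on with
  | _ n ih =>
    obtain rfl | hn1 := eq_or_ne n 1
    · refine ⟨V, .refl _ _, ?_⟩
      simp only [pow_one]
      exact hf.mono le_rfl (by push_cast; linarith)
    · obtain ⟨W, hW, hA⟩ := ih (n / 2) (by omega) (by omega)
      have hlog : Nat.log 2 n = Nat.log 2 (n / 2) + 1 :=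
        Nat.log_of_one_lt_of_le (by omega) (by omega)
      obtain ⟨W', hW', hA'⟩ := hA.exists_mul (hW.le h1) m hA
      rcases Nat.even_or_odd' n with ⟨j, rfl | rfl⟩
      · refine ⟨W', (hW.trans hW').mono (by rw [hlog]; nlinarith), ?_⟩
        have hj : 2 * j / 2 = j := by omega
        rw [hj] at hA'
        convert hA'.mono le_rfl _ using 2 with x
        · rw [two_mul, pow_add]
        · push_cast; linarith
      · obtain ⟨W'', hW'', hA''⟩ := hA'.exists_mul (hW'.le (hW.le h1)) m
          (hf.mono (hW.le.trans hW'.le) le_rfl)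
        refine ⟨W'', ((hW.trans hW').trans hW'').mono (by rw [hlog]; nlinarith), ?_⟩
        have hj : (2 * j + 1) / 2 = j := by omega
        rw [hj] at hA''
        convert hA''.mono le_rfl _ using 2 with x
        · rw [two_mul, pow_succ, pow_add]
        · push_cast; linarith

end gadgets

/-! ### Monomials and polynomials -/

section monomials

variable {d r : ℕ} {V : Submodule ℝ ((Fin d → ℝ) → ℝ)} {α : Fin d →₀ ℕ}

theorem unitApprox_coord (hV : affineFns d ≤ V) (l : Fin d) :
    UnitApprox (Set.Icc (0 : Fin d → ℝ) 1) V (fun x => x l) 0 :=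
  .of_mem (hV (coord_mem_affineFns l)) fun _ hx => ⟨hx.1 l, hx.2 l⟩

/-- A monomial of degree at most `r`, with one multiplication per factor. -/
theorem exists_unitApprox_monomial (hV : affineFns d ≤ V) (m : ℕ) (hα : α.degree ≤ r) :
    ∃ W, ReluExt (r * (2 * m + 3)) V W ∧ UnitApprox (Set.Icc (0 : Fin d → ℝ) 1) W
      (fun x => ∏ i, x i ^ α i) (r * (2 * (4 ^ m : ℝ)⁻¹)) := by
  obtain ⟨W, hW, hA⟩ := UnitApprox.exists_multiset_prod (S := Set.Icc (0 : Fin d → ℝ) 1)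
    (hV (one_mem_affineFns d)) m
    ((Finsupp.toMultiset α).map fun (l : Fin d) (x : Fin d → ℝ) => x l) (e := 0) (by
      intro f hf
      obtain ⟨l, -, rfl⟩ := Multiset.mem_map.1 hf
      exact unitApprox_coord hV l)
  have hcard : Multiset.card ((Finsupp.toMultiset α).map
      fun (l : Fin d) (x : Fin d → ℝ) => x l) = α.degree := by
    rw [Multiset.card_map, Finsupp.card_toMultiset]
    rfl
  rw [hcard] at hW hA
  refine ⟨W, hW.mono (Nat.mul_le_mul_right _ hα), ?_⟩
  convert hA.mono le_rfl (e' := r * (2 * (4 ^ m : ℝ)⁻¹)) _ using 2 with x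
  · classical
    rw [Multiset.map_map, Finset.prod_multiset_map_count, Finsupp.toFinset_toMultiset]
    simp only [Finsupp.count_toMultiset, Function.comp]
    refine (Finset.prod_subset (Finset.subset_univ _) fun i _ hi => ?_).symm
    rw [Finsupp.notMem_support_iff.1 hi, pow_zero]
  · rw [zero_add]
    gcongr

/-- A monomial of degree at most `r`, with the powers of variables computed by repeated
squaring. -/
theorem exists_unitApprox_monomial' (hV : affineFns d ≤ V) (m : ℕ) (hα : α.degree ≤ r)
    (hr : r ≠ 0) :
    ∃ W, ReluExt (d * ((2 * Nat.log 2 r + 1) * (2 * m + 3))) V W ∧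
      UnitApprox (Set.Icc (0 : Fin d → ℝ) 1) W
        (fun x => ∏ i, x i ^ α i) (4 * d * r * (2 * (4 ^ m : ℝ)⁻¹)) := by
  have hαi : ∀ i, α i ≤ r := fun i => (Finsupp.le_degree i α).trans hα
  have hδ : (0 : ℝ) < 2 * (4 ^ m : ℝ)⁻¹ := by positivity
  have key : ∀ T : Finset (Fin d), ∃ W, ReluExt (T.card * (2 * Nat.log 2 r * (2 * m + 3))) V W ∧
      ∀ l ∈ T, UnitApprox (Set.Icc (0 : Fin d → ℝ) 1) W (fun x => x l ^ α l)
        (r * (3 * (2 * (4 ^ m : ℝ)⁻¹))) := by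
    intro T
    induction T using Finset.induction with
    | empty => exact ⟨V, .refl _ _, by simp⟩
    | insert l T hl ih =>
      obtain ⟨W, hW, hA⟩ := ih
      have hVW := hV.trans hW.le
      obtain ⟨W', hW', hA'⟩ : ∃ W', ReluExt (2 * Nat.log 2 r * (2 * m + 3)) W W' ∧
          UnitApprox (Set.Icc (0 : Fin d → ℝ) 1) W' (fun x => x l ^ α l)
            (r * (3 * (2 * (4 ^ m : ℝ)⁻¹))) := by
        -- Repeated squaring starts from exponent 1, so the exponent 0 is handled apart, by the
        -- constant 1.
        rcases eq_or_ne (α l) 0 with h0 | h0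
        · refine ⟨W, .refl _ _, ?_⟩
          simp only [h0, pow_zero]
          exact (UnitApprox.one (hVW (one_mem_affineFns d))).mono le_rfl (by positivity)
        · obtain ⟨W', hW', hA'⟩ := (unitApprox_coord hVW l).exists_pow
            (hVW (one_mem_affineFns d)) m h0
          refine ⟨W', hW'.mono ?_, hA'.mono le_rfl ?_⟩
          · gcongr
            exact hαi l
          · have : (α l : ℝ) ≤ r := by exact_mod_cast hαi l
            nlinarith
      refine ⟨W', (hW.trans hW').mono (by rw [Finset.card_insert_of_notMem hl]; linarith), ?_⟩
      intro l' hl'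
      rcases Finset.mem_insert.1 hl' with rfl | h
      · exact hA'
      · exact (hA l' h).mono hW'.le le_rfl
  obtain ⟨W, hW, hA⟩ := key Finset.univ
  obtain ⟨W', hW', hA'⟩ := UnitApprox.exists_multiset_prod (S := Set.Icc (0 : Fin d → ℝ) 1)
    ((hV.trans hW.le) (one_mem_affineFns d)) m
    (Finset.univ.val.map fun (l : Fin d) (x : Fin d → ℝ) => x l ^ α l)
    (e := r * (3 * (2 * (4 ^ m : ℝ)⁻¹))) (by
      intro f hf
      obtain ⟨l, -, rfl⟩ := Multiset.mem_map.1 hf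
      exact hA l (Finset.mem_univ l))
  have hcard : Multiset.card (Finset.univ.val.map
      fun (l : Fin d) (x : Fin d → ℝ) => x l ^ α l) = d := by simp
  rw [hcard] at hW' hA'
  refine ⟨W', (hW.trans hW').mono ?_, ?_⟩
  · rw [Finset.card_univ, Fintype.card_fin]
    apply le_of_eq
    ring
  · have hr1 : (1 : ℝ) ≤ r := by exact_mod_cast Nat.one_le_iff_ne_zero.2 hr
    convert hA'.mono le_rfl (e' := 4 * d * r * (2 * (4 ^ m : ℝ)⁻¹)) _ using 2 with x
    · rw [Multiset.map_map]
      rfl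
    · have h2 : (d : ℝ) * (2 * (4 ^ m : ℝ)⁻¹) ≤ d * (2 * (4 ^ m : ℝ)⁻¹) * r :=
        le_mul_of_one_le_right (by positivity) hr1
      linarith

/-- From monomials to polynomials. -/
theorem exists_approx_polynomial (hV : affineFns d ≤ V) {p : MvPolynomial (Fin d) ℝ} {A e : ℝ}
    {c s : ℕ} (hp : ∀ α, |p.coeff α| ≤ A) (hA : 0 ≤ A) (he : 0 ≤ e) (hs : p.support.card ≤ s)
    (H : ∀ α ∈ p.support, ∀ W, affineFns d ≤ W → ∃ W', ReluExt c W W' ∧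
      UnitApprox (Set.Icc (0 : Fin d → ℝ) 1) W' (fun x => ∏ i, x i ^ α i) e) :
    ∃ W, ReluExt (s * c) V W ∧ ∃ h ∈ W, ∀ x ∈ Set.Icc (0 : Fin d → ℝ) 1,
      |h x - MvPolynomial.eval x p| ≤ s * (A * e) := by
  have key : ∀ T ⊆ p.support, ∃ W, ReluExt (T.card * c) V W ∧ ∃ h ∈ W,
      ∀ x ∈ Set.Icc (0 : Fin d → ℝ) 1,
        |h x - ∑ α ∈ T, p.coeff α * ∏ i, x i ^ α i| ≤ T.card * (A * e) := by
    intro T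
    induction T using Finset.induction with
    | empty => exact fun _ => ⟨V, .refl _ _, 0, V.zero_mem, by simp⟩
    | insert α T hα ih =>
      intro hT
      obtain ⟨W, hW, h, hh, herr⟩ := ih fun β hβ => hT (Finset.mem_insert_of_mem hβ)
      obtain ⟨W', hW', -, u, hu, hux⟩ := H α (hT (Finset.mem_insert_self _ _)) W (hV.trans hW.le)
      refine ⟨W', (hW.trans hW').mono (by rw [Finset.card_insert_of_notMem hα]; linarith), _,
        W'.add_mem (W'.smul_mem (p.coeff α) hu) (hW'.le hh), fun x hx => ?_⟩
      rw [Finset.sum_insert hα, Finset.card_insert_of_notMem hα]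
      have e1 : |p.coeff α * (u x - ∏ i, x i ^ α i)| ≤ A * e := by
        rw [abs_mul]
        exact mul_le_mul (hp α) (hux x hx).2 (abs_nonneg _) hA
      have e2 := abs_add_le (p.coeff α * (u x - ∏ i, x i ^ α i))
        (h x - ∑ α ∈ T, p.coeff α * ∏ i, x i ^ α i)
      have e3 := herr x hx
      simp only [Pi.add_apply, Pi.smul_apply, smul_eq_mul]
      push_cast
      rw [show p.coeff α * u x + h x
          - (p.coeff α * ∏ i, x i ^ α i + ∑ α ∈ T, p.coeff α * ∏ i, x i ^ α i)
        = p.coeff α * (u x - ∏ i, x i ^ α i)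
          + (h x - ∑ α ∈ T, p.coeff α * ∏ i, x i ^ α i) by ring]
      linarith
  obtain ⟨W, hW, h, hh, herr⟩ := key _ subset_rfl
  refine ⟨W, hW.mono (Nat.mul_le_mul_right _ hs), h, hh, fun x hx => ?_⟩
  rw [MvPolynomial.eval_eq']
  refine (herr x hx).trans ?_
  gcongr

end monomials

/-! ### Division by a factored geometric series -/

section division

variable {X : Type*} {S : Set X} {V : Submodule ℝ (X → ℝ)} {z : X → ℝ} {e : ℝ}

/-- The products `∏ (1 + z ^ 2 ^ j)`, rescaled to `[0, 1]`. -/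
theorem UnitApprox.exists_geom_prod (h1 : (fun _ => 1) ∈ V) (m t : ℕ) (he : 0 ≤ e)
    (hz : UnitApprox S V z e) : ∃ W, ReluExt (t * (4 * m + 6)) V W ∧
      UnitApprox S W (fun x => z x ^ 2 ^ t)
        (2 ^ t * (e + 2 * (4 ^ m : ℝ)⁻¹) - 2 * (4 ^ m : ℝ)⁻¹) ∧
      UnitApprox S W (fun x => ∏ j ∈ Finset.range t, (1 + z x ^ 2 ^ j) / 2)
        (2 ^ t * (e + 2 * (2 * (4 ^ m : ℝ)⁻¹))) := by
  have hδ : (0 : ℝ) < 2 * (4 ^ m : ℝ)⁻¹ := by positivity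
  induction t with
  | zero =>
    refine ⟨V, .refl _ _, ?_, ?_⟩
    · simpa using hz
    · simpa using (UnitApprox.one h1).mono le_rfl (by linarith)
  | succ t ih =>
    obtain ⟨W, hW, hA, hB⟩ := ih
    have h1W := hW.le h1
    -- Halving keeps the factor in [0, 1], as multiplication requires; the lost powers of 2 are
    -- restored by the scalar 2^t after all products are formed.
    have hC : UnitApprox S W (fun x => (1 + z x ^ 2 ^ t) / 2)
        ((2 ^ t * (e + 2 * (4 ^ m : ℝ)⁻¹) - 2 * (4 ^ m : ℝ)⁻¹) / 2) := by
      obtain ⟨hA, u, hu, hux⟩ := hA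
      refine ⟨fun x hx => ?_, _, lin_mem h1W hu hu (1 / 2) 0 (1 / 2), fun x hx => ⟨?_, ?_⟩⟩
      · obtain ⟨h0, h1⟩ := hA x hx
        constructor <;> linarith
      · obtain ⟨⟨h0, h1⟩, -⟩ := hux x hx
        constructor <;> linarith
      · have := (hux x hx).2
        rw [abs_le] at *
        constructor <;> linarith
    obtain ⟨W₁, hW₁, hA₁⟩ := hA.exists_mul h1W m hA
    obtain ⟨W₂, hW₂, hA₂⟩ := (hB.mono hW₁.le le_rfl).exists_mul (hW₁.le h1W) m
      (hC.mono hW₁.le le_rfl)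
    refine ⟨W₂, ((hW.trans hW₁).trans hW₂).mono (by linarith), ?_, ?_⟩
    · convert hA₁.mono hW₂.le _ using 2 with x
      · rw [pow_succ, mul_two, pow_add]
      · rw [pow_succ]; linarith
    · simp only [Finset.prod_range_succ]
      refine hA₂.mono le_rfl ?_
      have h2 : (1 : ℝ) ≤ 2 ^ t := one_le_pow₀ (by norm_num)
      rw [pow_succ]
      nlinarith

/-- The telescoping identity (1 - y)(1 + y)(1 + y²)(1 + y⁴)⋯ = 1 - y^(2^t): the rescaled product is
a partial geometric sum. -/
theorem geom_prod_mul (y : ℝ) (t : ℕ) :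
    2 ^ t * (∏ j ∈ Finset.range t, (1 + y ^ 2 ^ j) / 2) * (1 - y) = 1 - y ^ 2 ^ t := by
  induction t with
  | zero => simp
  | succ t ih =>
    rw [Finset.prod_range_succ, pow_succ, pow_succ 2 t, pow_mul,
      show (2 : ℝ) ^ t * 2 * ((∏ j ∈ Finset.range t, (1 + y ^ 2 ^ j) / 2) * ((1 + y ^ 2 ^ t) / 2))
        * (1 - y) = (2 ^ t * (∏ j ∈ Finset.range t, (1 + y ^ 2 ^ j) / 2) * (1 - y))
          * (1 + y ^ 2 ^ t) by ring, ih]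
    ring

/-- The worst-case truncation error of the series for 1/q, attained at q = 2^(-k). By 1 - u ≤ exp
(-u) the power is at most exp (-2^(k+L)) ≤ exp (-(k+L)), and exp (-k) absorbs the factor 2^k. -/
theorem two_pow_mul_one_sub_pow_le (k L : ℕ) :
    (2 : ℝ) ^ k * (1 - ((2 : ℝ) ^ k)⁻¹) ^ 2 ^ (2 * k + L) ≤ Real.exp (-L) := by
  have h2k : (1 : ℝ) ≤ 2 ^ k := one_le_pow₀ (by norm_num)
  have hinv : ((2 : ℝ) ^ k)⁻¹ ≤ 1 := inv_le_one_of_one_le₀ h2k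
  have h1 : (1 - ((2 : ℝ) ^ k)⁻¹) ^ 2 ^ (2 * k + L) ≤ Real.exp (-((k : ℝ) + L)) := by
    calc (1 - ((2 : ℝ) ^ k)⁻¹) ^ 2 ^ (2 * k + L)
        ≤ Real.exp (-((2 : ℝ) ^ k)⁻¹) ^ 2 ^ (2 * k + L) :=
          pow_le_pow_left₀ (by linarith) (Real.one_sub_le_exp_neg _) _
      _ = Real.exp (-(2 : ℝ) ^ (k + L)) := by
          rw [← Real.exp_nat_mul]
          congr 1
          push_cast
          rw [show 2 * k + L = k + L + k by ring, pow_add _ (k + L)]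
          field_simp
      _ ≤ Real.exp (-((k : ℝ) + L)) := by
          rw [Real.exp_le_exp]
          have : ((k + L : ℕ) : ℝ) < ((2 ^ (k + L) : ℕ) : ℝ) := by
            exact_mod_cast Nat.lt_two_pow_self
          push_cast at this
          linarith
  have h3 : (2 : ℝ) ^ k ≤ Real.exp k := by
    rw [← mul_one (k : ℝ), Real.exp_nat_mul]
    exact pow_le_pow_left₀ (by norm_num) (by linarith [Real.add_one_le_exp 1]) _
  calc _ ≤ Real.exp k * Real.exp (-((k : ℝ) + L)) := by gcongr
    _ = Real.exp (-L) := by rw [← Real.exp_add]; ring_nf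

/-- Division. -/
theorem exists_approx_div (h1 : (fun _ => 1) ∈ V) {k L n : ℕ} {ε : ℝ} {p q u v : X → ℝ}
    (hu : u ∈ V) (hv : v ∈ V) (hp : ∀ x ∈ S, p x ∈ Set.Icc (-1 : ℝ) 1)
    (hq : ∀ x ∈ S, q x ∈ Set.Icc (((2 : ℝ) ^ k)⁻¹) 1)
    (hL : Real.exp (-L) ≤ ε / 2) (hn : n = 2 * k + L + L + 3)
    (hup : ∀ x ∈ S, |u x - p x| ≤ (4 ^ n : ℝ)⁻¹) (hvq : ∀ x ∈ S, |v x - q x| ≤ (4 ^ n : ℝ)⁻¹) :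
    ∃ W, ReluExt ((2 * k + L) * (4 * n + 6) + 2 * n + 7) V W ∧
      ∃ h ∈ W, ∀ x ∈ S, |h x - p x / q x| ≤ ε := by
  set t := 2 * k + L with ht
  set η := (4 ^ n : ℝ)⁻¹ with hη
  have hη0 : 0 < η := by positivity
  -- Products are available only for values in [0, 1], so `p` is replaced by (p + 1)/2, and p R is
  -- recovered at the end as 2 ((p + 1)/2 · R) - R.
  obtain ⟨W₁, hW₁, hA₁⟩ := exists_unitApprox_of_approx (S := S) (f := fun x => (p x + 1) / 2)
    (e := η) h1 (lin_mem h1 hu hu (1 / 2) 0 (1 / 2)) (fun x hx => by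
      obtain ⟨h0, h1⟩ := hp x hx
      constructor <;> linarith) (fun x hx => by
      have := hup x hx
      rw [abs_le] at *
      constructor <;> linarith)
  have h1₁ := hW₁.le h1
  have hv₁ := hW₁.le hv
  obtain ⟨W₂, hW₂, hA₂⟩ := exists_unitApprox_of_approx (S := S) (f := fun x => 1 - q x)
    (e := η) h1₁ (lin_mem h1₁ hv₁ hv₁ (-1) 0 1) (fun x hx => by
      obtain ⟨h0, h1⟩ := hq x hx
      have : (0 : ℝ) < ((2 : ℝ) ^ k)⁻¹ := by positivity
      constructor <;> linarith) (fun x hx => by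
      have := hvq x hx
      rw [abs_le] at *
      constructor <;> linarith)
  have h1₂ := hW₂.le h1₁
  obtain ⟨W₃, hW₃, -, hA₃⟩ := hA₂.exists_geom_prod h1₂ n t hη0.le
  obtain ⟨W₄, hW₄, hA₄⟩ := (hA₁.mono (hW₂.le.trans hW₃.le) le_rfl).exists_mul (hW₃.le h1₂) n hA₃
  obtain ⟨-, w, hw, hwx⟩ := hA₃
  obtain ⟨-, y, hy, hyx⟩ := hA₄
  refine ⟨W₄, (((hW₁.trans hW₂).trans hW₃).trans hW₄).mono (by omega), _,
    lin_mem (hW₄.le (hW₃.le h1₂)) hy (hW₄.le hw) (2 ^ t * 2) (-2 ^ t) 0, fun x hx => ?_⟩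
  have hw' := (hwx x hx).2
  have hy' := (hyx x hx).2
  set R := ∏ j ∈ Finset.range t, (1 + (1 - q x) ^ 2 ^ j) / 2
  have hR : 2 ^ t * R * q x = 1 - (1 - q x) ^ 2 ^ t := by
    have := geom_prod_mul (1 - q x) t
    rwa [sub_sub_cancel] at this
  obtain ⟨hq0, hq1⟩ := hq x hx
  have h2k : (0 : ℝ) < ((2 : ℝ) ^ k)⁻¹ := by positivity
  have hqpos : 0 < q x := h2k.trans_le hq0
  have h2t : (1 : ℝ) ≤ 2 ^ t := one_le_pow₀ (by norm_num)
  -- the truncation error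
  have hE : |p x * (2 ^ t * R) - p x / q x| ≤ ε / 2 := by
    have : p x * (2 ^ t * R) - p x / q x = -p x * ((q x)⁻¹ * (1 - q x) ^ 2 ^ t) := by
      field_simp
      linear_combination p x * hR
    rw [this, abs_mul, abs_neg]
    have hnn : 0 ≤ (q x)⁻¹ * (1 - q x) ^ 2 ^ t :=
      mul_nonneg (by positivity) (pow_nonneg (by linarith) _)
    rw [abs_of_nonneg hnn]
    have hle : (q x)⁻¹ * (1 - q x) ^ 2 ^ t ≤ ε / 2 := by
      refine le_trans ?_ ((two_pow_mul_one_sub_pow_le k L).trans hL)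
      refine mul_le_mul ?_ ?_ (pow_nonneg (by linarith) _) (by positivity)
      · rw [inv_le_comm₀ hqpos (by positivity)]
        exact hq0
      · exact pow_le_pow_left₀ (by linarith) (by linarith) _
    exact (mul_le_of_le_one_left hnn (abs_le.2 (hp x hx))).trans hle
  -- the error of the network
  have hN : |2 ^ t * 2 * y x + -2 ^ t * w x + 0 - p x * (2 ^ t * R)| ≤ ε / 2 := by
    -- Up to 5 · 2^t η from `w` and 3 η + 5 · 2^t η from `y`, the latter doubled. The outer scalar
    -- contributes another 2^t, and n = t + L + 3 leaves 21/64 · 4^(-L).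
    have e1 : |2 * (y x - (p x + 1) / 2 * R) - (w x - R)| ≤ 2 ^ t * 21 * η := by
      rw [abs_le] at *
      constructor <;> nlinarith
    rw [show 2 ^ t * 2 * y x + -2 ^ t * w x + 0 - p x * (2 ^ t * R)
      = 2 ^ t * (2 * (y x - (p x + 1) / 2 * R) - (w x - R)) by ring, abs_mul,
      abs_of_nonneg (by positivity)]
    calc _ ≤ 2 ^ t * (2 ^ t * 21 * η) := by gcongr
      _ = 21 / 64 * (4 ^ L : ℝ)⁻¹ := by
        rw [hη, hn, pow_add (4 : ℝ), pow_add (4 : ℝ), show (4 : ℝ) ^ t = 2 ^ t * 2 ^ t by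
          rw [← mul_pow]; norm_num]
        field_simp
        norm_num
      _ ≤ 1 * Real.exp (-L) := by
        have : Real.exp L ≤ 4 ^ L := by
          rw [← mul_one (L : ℝ), Real.exp_nat_mul]
          exact pow_le_pow_left₀ (by positivity) (by linarith [Real.exp_one_lt_d9]) _
        rw [Real.exp_neg]
        gcongr
        norm_num
      _ ≤ ε / 2 := by linarith
  have := abs_add_le (2 ^ t * 2 * y x + -2 ^ t * w x + 0 - p x * (2 ^ t * R))
    (p x * (2 ^ t * R) - p x / q x)
  rw [sub_add_sub_cancel] at this
  linarith

end division

/-! ### Size estimates and the network for p/q -/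

/-- A network for `p / q`, given networks for the monomials. -/
theorem exists_net_of_monomials {d s c k L n : ℕ} {A e ε : ℝ} {p q : MvPolynomial (Fin d) ℝ}
    (hA : 0 ≤ A) (he : 0 ≤ e) (hps : p.support.card ≤ s) (hqs : q.support.card ≤ s)
    (hpA : ∀ α, |p.coeff α| ≤ A) (hqA : ∀ α, |q.coeff α| ≤ A)
    (hp : ∀ x ∈ Set.Icc (0 : Fin d → ℝ) 1, MvPolynomial.eval x p ∈ Set.Icc (-1 : ℝ) 1)
    (hq : ∀ x ∈ Set.Icc (0 : Fin d → ℝ) 1,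
      MvPolynomial.eval x q ∈ Set.Icc (((2 : ℝ) ^ k)⁻¹) 1)
    (hL : Real.exp (-L) ≤ ε / 2) (hn : n = 2 * k + L + L + 3)
    (hse : s * (A * e) ≤ (4 ^ n : ℝ)⁻¹)
    (H : ∀ α ∈ p.support ∪ q.support, ∀ W, affineFns d ≤ W → ∃ W', ReluExt c W W' ∧
      UnitApprox (Set.Icc (0 : Fin d → ℝ) 1) W' (fun x => ∏ i, x i ^ α i) e) :
    ∃ (N : ℕ) (net : ReLUNet d N),
      net.size ≤ 2 * (s * c) + ((2 * k + L) * (4 * n + 6) + 2 * n + 10) ∧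
      ∀ x ∈ Set.Icc (0 : Fin d → ℝ) 1,
        |net.eval x - MvPolynomial.eval x p / MvPolynomial.eval x q| ≤ ε := by
  obtain ⟨W₁, hW₁, u, hu, hux⟩ := exists_approx_polynomial le_rfl hpA hA he hps
    fun α hα => H α (Finset.mem_union_left _ hα)
  obtain ⟨W₂, hW₂, v, hv, hvx⟩ := exists_approx_polynomial hW₁.le hqA hA he hqs
    fun α hα => H α (Finset.mem_union_right _ hα)
  obtain ⟨W₃, hW₃, h, hh, hhx⟩ := exists_approx_div ((hW₁.trans hW₂).le (one_mem_affineFns d))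
    (hW₂.le hu) hv hp hq hL hn (fun x hx => (hux x hx).trans hse)
    (fun x hx => (hvx x hx).trans hse)
  obtain ⟨N, net, hsize, hev⟩ := ((hW₁.trans hW₂).trans hW₃).exists_eval_eq hh
  refine ⟨N, net, by omega, fun x hx => ?_⟩
  rw [hev]
  exact hhx x hx

/-- The number of nodes used for the division. -/
theorem division_size_le {k L n : ℕ} {l : ℝ} (hl : 0.69 ≤ l) (hL : (L : ℝ) ≤ l + 1)
    (hn : n = 2 * k + L + L + 3) :
    (n : ℝ) ≤ 13 * (((k : ℝ) + 1) * l) ∧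
    (((2 * k + L) * (4 * n + 6) + 2 * n + 10 : ℕ) : ℝ) ≤ 430 * (((k : ℝ) + 1) * l) ^ 2 := by
  have hk : (0 : ℝ) ≤ k := Nat.cast_nonneg k
  set y := ((k : ℝ) + 1) * l with hy
  have h1 : l ≤ y := by nlinarith
  have h2 : (k : ℝ) + 1 ≤ 1.5 * y := by nlinarith
  have hL0 : (0 : ℝ) ≤ L := Nat.cast_nonneg L
  have hn' : (n : ℝ) = 2 * k + L + L + 3 := by rw [hn]; push_cast; ring
  have ht : (2 * k + L : ℝ) ≤ 6 * y := by linarith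
  have hn1 : (n : ℝ) ≤ 13 * y := by linarith
  refine ⟨hn1, ?_⟩
  push_cast
  have h3 : (2 * k + L : ℝ) * (4 * n + 6) ≤ 6 * y * (61 * y) := by
    apply mul_le_mul ht _ (by positivity) (by positivity)
    linarith
  nlinarith

theorem sq_le_pow_seven_mul {K l : ℝ} (hK : 1 ≤ K) (hl : 0.69 ≤ l) :
    (K * l) ^ 2 ≤ 1.5 * (K ^ 7 * l ^ 3) := by
  have h1 : K ^ 2 ≤ K ^ 7 := pow_le_pow_right₀ hK (by norm_num)
  have h2 : l ^ 2 ≤ 1.5 * l ^ 3 := by nlinarith [sq_nonneg l]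
  rw [mul_pow]
  calc K ^ 2 * l ^ 2 ≤ K ^ 7 * (1.5 * l ^ 3) := by gcongr
    _ = _ := by ring

theorem le_mul_sq {y : ℝ} (hy : 0.69 ≤ y) : y ≤ 1.45 * y ^ 2 := by nlinarith

section branches

variable {d s r k : ℕ} {A ε : ℝ} {p q : MvPolynomial (Fin d) ℝ}

theorem log_two_div_ge {ε : ℝ} (hε0 : 0 < ε) (hε1 : ε ≤ 1) : 0.69 ≤ Real.log (2 / ε) := by
  have : Real.log 2 ≤ Real.log (2 / ε) :=
    Real.log_le_log (by norm_num) (by rw [le_div_iff₀ hε0]; linarith)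
  linarith [Real.log_two_gt_d9]

theorem exp_neg_ceil_log_le {x : ℝ} (hx : 0 < x) :
    Real.exp (-(⌈Real.log (2 / x)⌉₊ : ℝ)) ≤ x / 2 := by
  rw [← Real.exp_log (show 0 < x / 2 by positivity), Real.exp_le_exp,
    show Real.log (x / 2) = -Real.log (2 / x) by rw [← Real.log_inv, inv_div]]
  exact neg_le_neg (Nat.le_ceil _)

theorem le_four_pow_ceil_log {x : ℝ} (hx : 0 < x) : x ≤ 4 ^ ⌈Real.log x⌉₊ := by
  calc x = Real.exp (Real.log x) := (Real.exp_log hx).symm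
    _ ≤ Real.exp (⌈Real.log x⌉₊ * 1) := by
      rw [Real.exp_le_exp, mul_one]
      exact Nat.le_ceil _
    _ ≤ 4 ^ ⌈Real.log x⌉₊ := by
      rw [Real.exp_nat_mul]
      exact pow_le_pow_left₀ (by positivity) (by linarith [Real.exp_one_lt_d9]) _

/-- The network that computes every monomial factor by factor. -/
theorem exists_net_of_degree (hε0 : 0 < ε) (hε1 : ε ≤ 1) (hA : 1 ≤ A) (hr : r ≠ 0) (hs : s ≠ 0)
    (hpr : p.totalDegree ≤ r) (hqr : q.totalDegree ≤ r)
    (hps : p.support.card ≤ s) (hqs : q.support.card ≤ s)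
    (hpA : ∀ α, |p.coeff α| ≤ A) (hqA : ∀ α, |q.coeff α| ≤ A)
    (hp : ∀ x ∈ Set.Icc (0 : Fin d → ℝ) 1, MvPolynomial.eval x p ∈ Set.Icc (-1 : ℝ) 1)
    (hq : ∀ x ∈ Set.Icc (0 : Fin d → ℝ) 1,
      MvPolynomial.eval x q ∈ Set.Icc (((2 : ℝ) ^ k)⁻¹) 1) :
    ∃ (N : ℕ) (net : ReLUNet d N),
      (net.size : ℝ) ≤ 1000 * (((k : ℝ) + 1) ^ 7 * Real.log (2 / ε) ^ 3
        + (s : ℝ) * r * ((k : ℝ) + 1) * Real.log (A * s * r / ε)) ∧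
      ∀ x ∈ Set.Icc (0 : Fin d → ℝ) 1,
        |net.eval x - MvPolynomial.eval x p / MvPolynomial.eval x q| ≤ ε := by
  have hs1 : (1 : ℝ) ≤ s := by exact_mod_cast Nat.one_le_iff_ne_zero.2 hs
  have hr1 : (1 : ℝ) ≤ r := by exact_mod_cast Nat.one_le_iff_ne_zero.2 hr
  have hX1 : 1 ≤ A * s * r := one_le_mul_of_one_le_of_one_le
    (one_le_mul_of_one_le_of_one_le hA hs1) hr1
  have hXε : 1 ≤ A * s * r / ε := by rw [le_div_iff₀ hε0]; linarith
  have hl := log_two_div_ge hε0 hε1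
  have hlam0 : 0 ≤ Real.log (A * s * r / ε) := Real.log_nonneg hXε
  have hllam : Real.log (2 / ε) ≤ Real.log 2 + Real.log (A * s * r / ε) := by
    rw [← Real.log_mul (by norm_num) (by positivity)]
    apply Real.log_le_log (by positivity)
    rw [← mul_div_assoc]
    gcongr
    linarith
  obtain ⟨L, hLdef⟩ : ∃ L, L = ⌈Real.log (2 / ε)⌉₊ := ⟨_, rfl⟩
  obtain ⟨M, hMdef⟩ : ∃ M, M = ⌈Real.log (A * s * r / ε)⌉₊ := ⟨_, rfl⟩
  obtain ⟨n, hn⟩ : ∃ n, n = 2 * k + L + L + 3 := ⟨_, rfl⟩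
  have hL : (L : ℝ) ≤ Real.log (2 / ε) + 1 := hLdef ▸ (Nat.ceil_lt_add_one (by linarith)).le
  have hM : (M : ℝ) ≤ Real.log (A * s * r / ε) + 1 := hMdef ▸ (Nat.ceil_lt_add_one hlam0).le
  -- Multiplication accuracy n + M + 1: the M extra digits pay for the factor A s r ≤ 4^M, the last
  -- one for the factor 2.
  have hse : s * (A * (r * (2 * (4 ^ (n + M + 1) : ℝ)⁻¹))) ≤ (4 ^ n : ℝ)⁻¹ := by
    have h1 : A * s * r ≤ 4 ^ M := by
      refine le_trans ?_ (hMdef ▸ le_four_pow_ceil_log (by positivity))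
      exact le_div_self (by positivity) hε0 hε1
    rw [pow_succ, pow_add, mul_inv, mul_inv]
    calc _ = (4 ^ n : ℝ)⁻¹ * ((A * s * r) * (4 ^ M : ℝ)⁻¹ * (1 / 2)) := by ring
      _ ≤ (4 ^ n : ℝ)⁻¹ * (4 ^ M * (4 ^ M : ℝ)⁻¹ * 1) := by gcongr; norm_num
      _ = (4 ^ n : ℝ)⁻¹ := by
        rw [mul_inv_cancel₀ (by positivity)]; ring
  obtain ⟨N, net, hsize, hnet⟩ := exists_net_of_monomials (c := r * (2 * (n + M + 1) + 3))
    (e := r * (2 * (4 ^ (n + M + 1) : ℝ)⁻¹)) (by linarith) (by positivity) hps hqs hpA hqA hp hq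
    (hLdef ▸ exp_neg_ceil_log_le hε0) hn hse
    (fun α hα W hW => exists_unitApprox_monomial hW _ (by
      rcases Finset.mem_union.1 hα with h | h
      · exact (MvPolynomial.le_totalDegree h).trans hpr
      · exact (MvPolynomial.le_totalDegree h).trans hqr))
  refine ⟨N, net, ?_, hnet⟩
  obtain ⟨hn13, hdiv⟩ := division_size_le (k := k) hl hL hn
  have hK : (1 : ℝ) ≤ (k : ℝ) + 1 := by linarith [Nat.cast_nonneg (α := ℝ) k]
  have hsq := sq_le_pow_seven_mul hK hl
  have hn' : (n : ℝ) = 2 * k + L + L + 3 := by rw [hn]; push_cast; ring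
  set l := Real.log (2 / ε)
  set lam := Real.log (A * s * r / ε)
  set K := (k : ℝ) + 1
  have hsize' : (net.size : ℝ) ≤ 2 * (s * (r * (2 * (n + M + 1) + 3)))
      + (((2 * k + L) * (4 * n + 6) + 2 * n + 10 : ℕ) : ℝ) := by exact_mod_cast hsize
  have hB : (0 : ℝ) ≤ s * r * K * lam := by positivity
  suffices h : 2 * ((s : ℝ) * (r * (2 * (n + M + 1) + 3)))
      ≤ 120 * (K * l) ^ 2 + 100 * (s * r * K * lam) by linarith
  -- If `lam` is bounded below, constants and `l` are absorbed by it. Otherwise A s r / ε < 2 forces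
  -- s r ≤ 1 by integrality, and the monomial cost fits into the division term.
  rcases le_or_gt (0.69 : ℝ) lam with h | h
  · have h1 : lam ≤ K * lam := le_mul_of_one_le_left hlam0 hK
    have h2 : K ≤ 1.5 * (K * lam) := by
      linarith [mul_le_mul_of_nonneg_left h (zero_le_one.trans hK)]
    have h3 : (2 * (n + M + 1) + 3 : ℝ) ≤ 46 * (K * lam) := by
      linarith [Real.log_two_lt_d9, show K = (k : ℝ) + 1 from rfl]
    calc 2 * ((s : ℝ) * (r * (2 * (n + M + 1) + 3)))
        ≤ 2 * ((s : ℝ) * (r * (46 * (K * lam)))) := by gcongr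
      _ = 92 * (s * r * K * lam) := by ring
      _ ≤ _ := by linarith [sq_nonneg (K * l)]
  · have hlt : A * s * r / ε < 2 := by
      by_contra! hcon
      have := Real.log_le_log (by norm_num) hcon
      linarith [Real.log_two_gt_d9]
    rw [div_lt_iff₀ hε0] at hlt
    have hsr : (s : ℝ) * r < 2 := by
      have h1 : (s : ℝ) * r ≤ s * r * A := le_mul_of_one_le_right (by positivity) hA
      linarith
    have hsr1 : (s : ℝ) * r ≤ 1 := by
      have : s * r < 2 := by exact_mod_cast hsr
      exact_mod_cast Nat.lt_succ_iff.1 this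
    have hy : 0.69 ≤ K * l := hl.trans (le_mul_of_one_le_left (by linarith) hK)
    calc 2 * ((s : ℝ) * (r * (2 * (n + M + 1) + 3)))
        = (s * r) * (2 * (2 * (n + M + 1) + 3)) := by ring
      _ ≤ 1 * (2 * (2 * (n + M + 1) + 3)) := by gcongr
      _ ≤ 82.5 * (K * l) := by linarith
      _ ≤ 120 * (K * l) ^ 2 := by linarith [le_mul_sq hy]
      _ ≤ _ := by linarith

/-- The network that computes the powers in every monomial by repeated squaring. -/
theorem exists_net_of_dim (hε0 : 0 < ε) (hε1 : ε ≤ 1) (hA : 1 ≤ A) (hr : r ≠ 0) (hs : s ≠ 0)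
    (hd : d ≠ 0) (hpr : p.totalDegree ≤ r) (hqr : q.totalDegree ≤ r)
    (hps : p.support.card ≤ s) (hqs : q.support.card ≤ s)
    (hpA : ∀ α, |p.coeff α| ≤ A) (hqA : ∀ α, |q.coeff α| ≤ A)
    (hp : ∀ x ∈ Set.Icc (0 : Fin d → ℝ) 1, MvPolynomial.eval x p ∈ Set.Icc (-1 : ℝ) 1)
    (hq : ∀ x ∈ Set.Icc (0 : Fin d → ℝ) 1,
      MvPolynomial.eval x q ∈ Set.Icc (((2 : ℝ) ^ k)⁻¹) 1) :
    ∃ (N : ℕ) (net : ReLUNet d N),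
      (net.size : ℝ) ≤ 1000 * (((k : ℝ) + 1) ^ 7 * Real.log (2 / ε) ^ 3
        + (s : ℝ) * d * ((k : ℝ) + 1) ^ 2 * Real.log (A * d * s * r / ε) ^ 2) ∧
      ∀ x ∈ Set.Icc (0 : Fin d → ℝ) 1,
        |net.eval x - MvPolynomial.eval x p / MvPolynomial.eval x q| ≤ ε := by
  have hs1 : (1 : ℝ) ≤ s := by exact_mod_cast Nat.one_le_iff_ne_zero.2 hs
  have hr1 : (1 : ℝ) ≤ r := by exact_mod_cast Nat.one_le_iff_ne_zero.2 hr
  have hd1 : (1 : ℝ) ≤ d := by exact_mod_cast Nat.one_le_iff_ne_zero.2 hd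
  have hX1' : 1 ≤ A * d * s := one_le_mul_of_one_le_of_one_le
    (one_le_mul_of_one_le_of_one_le hA hd1) hs1
  have hX1 : 1 ≤ A * d * s * r := one_le_mul_of_one_le_of_one_le hX1' hr1
  have hXε : 1 ≤ A * d * s * r / ε := by rw [le_div_iff₀ hε0]; linarith
  have hXself : A * d * s * r ≤ A * d * s * r / ε := le_div_self (by positivity) hε0 hε1
  have hl := log_two_div_ge hε0 hε1
  have hlam0 : 0 ≤ Real.log (A * d * s * r / ε) := Real.log_nonneg hXε
  have hllam : Real.log (2 / ε) ≤ Real.log 2 + Real.log (A * d * s * r / ε) := by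
    rw [← Real.log_mul (by norm_num) (by positivity)]
    apply Real.log_le_log (by positivity)
    rw [← mul_div_assoc]
    gcongr
    linarith
  have hlogr : 0.69 * (Nat.log 2 r : ℝ) ≤ Real.log (A * d * s * r / ε) := by
    have h1 : ((2 : ℝ) ^ Nat.log 2 r) ≤ A * d * s * r / ε := by
      have : ((2 ^ Nat.log 2 r : ℕ) : ℝ) ≤ r := by exact_mod_cast Nat.pow_log_le_self 2 hr
      push_cast at this
      nlinarith
    have h2 := Real.log_le_log (by positivity) h1
    rw [Real.log_pow] at h2
    nlinarith [Real.log_two_gt_d9, Nat.cast_nonneg (α := ℝ) (Nat.log 2 r)]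
  obtain ⟨L, hLdef⟩ : ∃ L, L = ⌈Real.log (2 / ε)⌉₊ := ⟨_, rfl⟩
  obtain ⟨M, hMdef⟩ : ∃ M, M = ⌈Real.log (A * d * s * r / ε)⌉₊ := ⟨_, rfl⟩
  obtain ⟨n, hn⟩ : ∃ n, n = 2 * k + L + L + 3 := ⟨_, rfl⟩
  have hL : (L : ℝ) ≤ Real.log (2 / ε) + 1 := hLdef ▸ (Nat.ceil_lt_add_one (by linarith)).le
  have hM : (M : ℝ) ≤ Real.log (A * d * s * r / ε) + 1 :=
    hMdef ▸ (Nat.ceil_lt_add_one hlam0).le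
  have hse : s * (A * (4 * d * r * (2 * (4 ^ (n + M + 2) : ℝ)⁻¹))) ≤ (4 ^ n : ℝ)⁻¹ := by
    have h1 : A * d * s * r ≤ 4 ^ M :=
      hXself.trans (hMdef ▸ le_four_pow_ceil_log (by positivity))
    rw [pow_add, pow_add, mul_inv, mul_inv]
    calc _ = (4 ^ n : ℝ)⁻¹ * ((A * d * s * r) * (4 ^ M : ℝ)⁻¹ * (1 / 2)) := by ring
      _ ≤ (4 ^ n : ℝ)⁻¹ * (4 ^ M * (4 ^ M : ℝ)⁻¹ * 1) := by gcongr; norm_num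
      _ = (4 ^ n : ℝ)⁻¹ := by
        rw [mul_inv_cancel₀ (by positivity)]; ring
  obtain ⟨N, net, hsize, hnet⟩ := exists_net_of_monomials
    (c := d * ((2 * Nat.log 2 r + 1) * (2 * (n + M + 2) + 3)))
    (e := 4 * d * r * (2 * (4 ^ (n + M + 2) : ℝ)⁻¹)) (by linarith) (by positivity)
    hps hqs hpA hqA hp hq (hLdef ▸ exp_neg_ceil_log_le hε0) hn hse
    (fun α hα W hW => exists_unitApprox_monomial' hW _ (by
      rcases Finset.mem_union.1 hα with h | h
      · exact (MvPolynomial.le_totalDegree h).trans hpr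
      · exact (MvPolynomial.le_totalDegree h).trans hqr) hr)
  refine ⟨N, net, ?_, hnet⟩
  obtain ⟨hn13, hdiv⟩ := division_size_le (k := k) hl hL hn
  have hK : (1 : ℝ) ≤ (k : ℝ) + 1 := by linarith [Nat.cast_nonneg (α := ℝ) k]
  have hsq := sq_le_pow_seven_mul hK hl
  have hn' : (n : ℝ) = 2 * k + L + L + 3 := by rw [hn]; push_cast; ring
  set l := Real.log (2 / ε)
  set lam := Real.log (A * d * s * r / ε)
  set K := (k : ℝ) + 1
  have hsize' : (net.size : ℝ)
      ≤ 2 * (s * (d * ((2 * (Nat.log 2 r : ℕ) + 1) * (2 * (n + M + 2) + 3))))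
      + (((2 * k + L) * (4 * n + 6) + 2 * n + 10 : ℕ) : ℝ) := by exact_mod_cast hsize
  have hB : (0 : ℝ) ≤ s * d * K ^ 2 * lam ^ 2 := by positivity
  suffices h : 2 * ((s : ℝ) * (d * ((2 * (Nat.log 2 r : ℕ) + 1) * (2 * (n + M + 2) + 3))))
      ≤ 120 * (K * l) ^ 2 + 460 * (s * d * K ^ 2 * lam ^ 2) by linarith
  rcases le_or_gt (0.69 : ℝ) lam with h | h
  · have h1 : lam ≤ K * lam := le_mul_of_one_le_left hlam0 hK
    have h2 : K ≤ 1.5 * (K * lam) := by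
      linarith [mul_le_mul_of_nonneg_left h (zero_le_one.trans hK)]
    have h3 : (2 * (n + M + 2) + 3 : ℝ) ≤ 50 * (K * lam) := by
      linarith [Real.log_two_lt_d9, show K = (k : ℝ) + 1 from rfl]
    have h4 : (2 * (Nat.log 2 r : ℕ) + 1 : ℝ) ≤ 4.5 * (K * lam) := by linarith
    calc 2 * ((s : ℝ) * (d * ((2 * (Nat.log 2 r : ℕ) + 1) * (2 * (n + M + 2) + 3))))
        ≤ 2 * ((s : ℝ) * (d * ((4.5 * (K * lam)) * (50 * (K * lam))))) := by gcongr
      _ = 450 * (s * d * K ^ 2 * lam ^ 2) := by ring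
      _ ≤ _ := by linarith [sq_nonneg (K * l)]
  · have hlt : A * d * s * r / ε < 2 := by
      by_contra! hcon
      have := Real.log_le_log (by norm_num) hcon
      linarith [Real.log_two_gt_d9]
    rw [div_lt_iff₀ hε0] at hlt
    have hsd : (s : ℝ) * d < 2 := by
      have h1 : (1 : ℝ) ≤ A * r := one_le_mul_of_one_le_of_one_le hA hr1
      have h2 : (s : ℝ) * d ≤ (s * d) * (A * r) := le_mul_of_one_le_right (by positivity) h1
      linarith
    have hsd1 : (s : ℝ) * d ≤ 1 := by
      have : s * d < 2 := by exact_mod_cast hsd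
      exact_mod_cast Nat.lt_succ_iff.1 this
    -- A small `lam` bounds `r` as well, so the squaring overhead disappears.
    have hlog0 : Nat.log 2 r = 0 := by
      by_contra hne
      have : (1 : ℝ) ≤ (Nat.log 2 r : ℕ) := by exact_mod_cast Nat.one_le_iff_ne_zero.2 hne
      linarith
    have hy : 0.69 ≤ K * l := hl.trans (le_mul_of_one_le_left (by linarith) hK)
    rw [hlog0]
    calc 2 * ((s : ℝ) * (d * ((2 * ((0 : ℕ) : ℝ) + 1) * (2 * (n + M + 2) + 3))))
        = (s * d) * (2 * (2 * (n + M + 2) + 3)) := by push_cast; ring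
      _ ≤ 1 * (2 * (2 * (n + M + 2) + 3)) := by gcongr
      _ ≤ 82.5 * (K * l) := by linarith
      _ ≤ 120 * (K * l) ^ 2 := by linarith [le_mul_sq hy]
      _ ≤ _ := by linarith

end branches

/-- The network with no ReLU nodes and constant output. -/
def ReLUNet.const (d : ℕ) (c : ℝ) : ReLUNet d 0 where
  inW := 0
  nodeW := 0
  bias := 0
  acyclic i := i.elim0
  outW := 0
  outB := c

/-- ReLU networks approximate rational functions. -/
theorem relu_approximates_rational : ∃ C : ℝ, 0 < C ∧
      ∀ (ε : ℝ), 0 < ε → ε ≤ 1 → ∀ (k d r s : ℕ) (A : ℝ), 1 ≤ A →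
      ∀ (p q : MvPolynomial (Fin d) ℝ),
        p.totalDegree ≤ r → q.totalDegree ≤ r →
        p.support.card ≤ s → q.support.card ≤ s →
        (∀ α : Fin d →₀ ℕ, |p.coeff α| ≤ A) → (∀ α : Fin d →₀ ℕ, |q.coeff α| ≤ A) →
        (∀ x ∈ Set.Icc (0 : Fin d → ℝ) 1, MvPolynomial.eval x p ∈ Set.Icc (-1 : ℝ) 1) →
        (∀ x ∈ Set.Icc (0 : Fin d → ℝ) 1,
          MvPolynomial.eval x q ∈ Set.Icc (((2 : ℝ) ^ k)⁻¹) 1) →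
        ∃ (N : ℕ) (net : ReLUNet d N),
          (net.size : ℝ) ≤
            C * (((k : ℝ) + 1) ^ 7 * Real.log (2 / ε) ^ 3
              + min ((s : ℝ) * r * ((k : ℝ) + 1) * Real.log (A * s * r / ε))
                  ((s : ℝ) * d * ((k : ℝ) + 1) ^ 2 * Real.log (A * d * s * r / ε) ^ 2)) ∧
          ∀ x ∈ Set.Icc (0 : Fin d → ℝ) 1,
            |net.eval x - MvPolynomial.eval x p / MvPolynomial.eval x q| ≤ ε := by
  refine ⟨1000, by norm_num, fun ε hε0 hε1 k d r s A hA p q hpr hqr hps hqs hpA hqA hp hq => ?_⟩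
  have hs : s ≠ 0 := by
    rintro rfl
    have h0 : q = 0 := by simpa using hqs
    have h1 := (hq 0 (by simp)).1
    rw [h0, map_zero] at h1
    have : (0 : ℝ) < ((2 : ℝ) ^ k)⁻¹ := by positivity
    linarith
  -- Here `p` and `q` are constants, and the single output node suffices.
  by_cases hrd : r = 0 ∨ d = 0
  · have hp0 : p = MvPolynomial.C (p.coeff 0) := by
      rcases hrd with rfl | rfl
      · exact MvPolynomial.totalDegree_eq_zero_iff_eq_C.1 (Nat.le_zero.1 hpr)
      · exact MvPolynomial.eq_C_of_isEmpty p
    have hq0 : q = MvPolynomial.C (q.coeff 0) := by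
      rcases hrd with rfl | rfl
      · exact MvPolynomial.totalDegree_eq_zero_iff_eq_C.1 (Nat.le_zero.1 hqr)
      · exact MvPolynomial.eq_C_of_isEmpty q
    refine ⟨0, ReLUNet.const d (p.coeff 0 / q.coeff 0), ?_, fun x _ => ?_⟩
    · have hl := log_two_div_ge hε0 hε1
      have hmin : 0 ≤ min ((s : ℝ) * r * ((k : ℝ) + 1) * Real.log (A * s * r / ε))
          ((s : ℝ) * d * ((k : ℝ) + 1) ^ 2 * Real.log (A * d * s * r / ε) ^ 2) := by
        refine le_min ?_ (by positivity)
        rcases eq_or_ne r 0 with rfl | hr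
        · simp
        · have hs1 : (1 : ℝ) ≤ s := by exact_mod_cast Nat.one_le_iff_ne_zero.2 hs
          have hr1 : (1 : ℝ) ≤ r := by exact_mod_cast Nat.one_le_iff_ne_zero.2 hr
          have hX1 : 1 ≤ A * s * r := one_le_mul_of_one_le_of_one_le
            (one_le_mul_of_one_le_of_one_le hA hs1) hr1
          have := Real.log_nonneg (hX1.trans (le_div_self (by linarith) hε0 hε1))
          positivity
      have h1 := sq_le_pow_seven_mul (K := (k : ℝ) + 1) (by linarith [Nat.cast_nonneg (α := ℝ) k])
        hl
      have h2 : (0.69 : ℝ) ≤ ((k : ℝ) + 1) * Real.log (2 / ε) := by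
        nlinarith [Nat.cast_nonneg (α := ℝ) k]
      simp only [ReLUNet.size]
      push_cast
      nlinarith
    · rw [hp0, hq0]
      simp [ReLUNet.eval, ReLUNet.const, hε0.le]
  · push Not at hrd
    rcases min_choice ((s : ℝ) * r * ((k : ℝ) + 1) * Real.log (A * s * r / ε))
      ((s : ℝ) * d * ((k : ℝ) + 1) ^ 2 * Real.log (A * d * s * r / ε) ^ 2) with h | h
    · rw [h]
      exact exists_net_of_degree hε0 hε1 hA hrd.1 hs hpr hqr hps hqs hpA hqA hp hq
    · rw [h]
      exact exists_net_of_dim hε0 hε1 hA hrd.1 hs hrd.2 hpr hqr hps hqs hpA hqA hp hq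

/-! ### Rational approximation of ReLU -/

section newman

/-- A polynomial `N` for which `N (-x)` is much smaller than `N x` on `(0, 2]`, away from `0`. -/
noncomputable def newmanPoly (L : ℕ) : Polynomial ℝ :=
  (∏ i ∈ Finset.range (L + 1), (Polynomial.X + Polynomial.C (2 * ((2 : ℝ) ^ i)⁻¹))) ^ (2 * L)

theorem newmanPoly_eval (L : ℕ) (x : ℝ) : (newmanPoly L).eval x
    = (∏ i ∈ Finset.range (L + 1), (x + 2 * ((2 : ℝ) ^ i)⁻¹)) ^ (2 * L) := by
  simp [newmanPoly, Polynomial.eval_prod]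

theorem newmanPoly_natDegree_le (L : ℕ) : (newmanPoly L).natDegree ≤ 2 * L * (L + 1) := by
  refine Polynomial.natDegree_pow_le.trans (Nat.mul_le_mul_left _ ?_)
  refine (Polynomial.natDegree_prod_le _ _).trans ?_
  simp only [Polynomial.natDegree_X_add_C, Finset.sum_const, Finset.card_range, smul_eq_mul,
    mul_one, le_refl]

theorem newmanPoly_eval_nonneg (L : ℕ) (x : ℝ) : 0 ≤ (newmanPoly L).eval x := by
  rw [newmanPoly_eval, pow_mul]
  positivity

theorem newmanPoly_eval_pos (L : ℕ) {x : ℝ} (hx : 0 ≤ x) : 0 < (newmanPoly L).eval x := by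
  rw [newmanPoly_eval]
  exact pow_pos (Finset.prod_pos fun i _ => by positivity) _

theorem exists_dyadic {x : ℝ} (hx2 : x ≤ 2) (L : ℕ) (hL : 2 * ((2 : ℝ) ^ L)⁻¹ < x) :
    ∃ i < L, ((2 : ℝ) ^ i)⁻¹ ≤ x ∧ x ≤ 2 * ((2 : ℝ) ^ i)⁻¹ := by
  induction L with
  | zero => norm_num at hL; linarith
  | succ L ih =>
    rcases lt_or_ge (2 * ((2 : ℝ) ^ L)⁻¹) x with h | h
    · obtain ⟨i, hi, h'⟩ := ih h
      exact ⟨i, by omega, h'⟩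
    · refine ⟨L, by omega, ?_, h⟩
      rw [pow_succ, mul_inv] at hL
      linarith

/-- Pick the dyadic node a = 2 · 2^(-i) with a/2 ≤ x ≤ a. Its factor satisfies (a - x)/(a + x) ≤
1/3, the other ratios have modulus at most 1, and the exponent 2L gives 9^(-L) ≤ 2^(-L). -/
theorem newmanPoly_eval_neg_le (L : ℕ) {x : ℝ} (hx0 : 0 ≤ x) (hx2 : x ≤ 2)
    (hL : 2 * ((2 : ℝ) ^ L)⁻¹ < x) :
    (newmanPoly L).eval (-x) ≤ ((2 : ℝ) ^ L)⁻¹ * (newmanPoly L).eval x := by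
  obtain ⟨i, hi, h1, h2⟩ := exists_dyadic hx2 L hL
  have hi' : i ∈ Finset.range (L + 1) := Finset.mem_range.2 (by omega)
  have hprod : |∏ i ∈ Finset.range (L + 1), (-x + 2 * ((2 : ℝ) ^ i)⁻¹)|
      ≤ 1 / 3 * ∏ i ∈ Finset.range (L + 1), (x + 2 * ((2 : ℝ) ^ i)⁻¹) := by
    rw [Finset.abs_prod, ← Finset.mul_prod_erase _ _ hi', ← Finset.mul_prod_erase _ _ hi',
      ← mul_assoc]
    refine mul_le_mul ?_ ?_ (Finset.prod_nonneg fun _ _ => abs_nonneg _) (by positivity)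
    · rw [abs_of_nonneg (by linarith)]
      linarith
    · refine Finset.prod_le_prod (fun _ _ => abs_nonneg _) fun j _ => ?_
      have : 0 < 2 * ((2 : ℝ) ^ j)⁻¹ := by positivity
      rw [abs_le]
      constructor <;> linarith
  rw [newmanPoly_eval, newmanPoly_eval, ← (even_two_mul L).pow_abs]
  calc _ ≤ (1 / 3 * ∏ i ∈ Finset.range (L + 1), (x + 2 * ((2 : ℝ) ^ i)⁻¹)) ^ (2 * L) :=
        pow_le_pow_left₀ (abs_nonneg _) hprod _
    _ = (1 / 9) ^ L * (∏ i ∈ Finset.range (L + 1), (x + 2 * ((2 : ℝ) ^ i)⁻¹)) ^ (2 * L) := by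
        rw [mul_pow, pow_mul]; norm_num
    _ ≤ _ := by
        rw [← inv_pow]
        refine mul_le_mul_of_nonneg_right
          (pow_le_pow_left₀ (by norm_num) (by norm_num) _) ?_
        rw [pow_mul]
        positivity

/-- This quotient is the distance from x to x N(x) / (N(x) + N(-x)). Below the smallest node the
bound on x itself is enough; above it, N(-x) is negligible against N(x). -/
theorem newman_error (L : ℕ) {x : ℝ} (hx0 : 0 ≤ x) (hx2 : x ≤ 2) :
    x * (newmanPoly L).eval (-x) / ((newmanPoly L).eval x + (newmanPoly L).eval (-x))
      ≤ 2 * ((2 : ℝ) ^ L)⁻¹ := by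
  have hp := newmanPoly_eval_pos L hx0
  have hn := newmanPoly_eval_nonneg L (-x)
  rw [div_le_iff₀ (by linarith)]
  have h0 : 0 < ((2 : ℝ) ^ L)⁻¹ := by positivity
  rcases le_or_gt x (2 * ((2 : ℝ) ^ L)⁻¹) with h | h
  · calc _ ≤ 2 * ((2 : ℝ) ^ L)⁻¹ * (newmanPoly L).eval (-x) := by gcongr
      _ ≤ _ := by
        apply mul_le_mul_of_nonneg_left _ (by positivity)
        linarith
  · calc _ ≤ 2 * (((2 : ℝ) ^ L)⁻¹ * (newmanPoly L).eval x) := by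
          gcongr
          exact newmanPoly_eval_neg_le L hx0 hx2 h
      _ ≤ _ := by
        rw [← mul_assoc]
        apply mul_le_mul_of_nonneg_left _ (by positivity)
        linarith

/-- Newman's theorem: rational approximation of `relu` on `[-2, 2]`. -/
theorem exists_rational_approx_relu {δ : ℝ} (hδ0 : 0 < δ) (hδ : δ ≤ 1 / 2) :
    ∃ (r : ℕ) (P Q : Polynomial ℝ), (r : ℝ) ≤ 80 * Real.log (1 / δ) ^ 2 ∧ P.natDegree ≤ r ∧
      Q.natDegree ≤ r ∧ (∀ x, 0 < Q.eval x) ∧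
      ∀ x ∈ Set.Icc (-2 : ℝ) 2, |relu x - P.eval x / Q.eval x| ≤ δ := by
  have hlam : 0.69 ≤ Real.log (1 / δ) := by
    have : Real.log 2 ≤ Real.log (1 / δ) :=
      Real.log_le_log (by norm_num) (by rw [le_div_iff₀ hδ0]; linarith)
    linarith [Real.log_two_gt_d9]
  have hlog : Real.log (2 / δ) = Real.log 2 + Real.log (1 / δ) := by
    rw [← Real.log_mul (by norm_num) (by positivity), mul_one_div]
  -- The factor 2 compensates for the base: 2 ln 2 > 1 gives 2^L ≥ 2/δ.
  obtain ⟨L, hLdef⟩ : ∃ L, L = ⌈2 * Real.log (2 / δ)⌉₊ := ⟨_, rfl⟩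
  have hL1 : 2 * Real.log (2 / δ) ≤ L := hLdef ▸ Nat.le_ceil _
  have hL2 : (L : ℝ) ≤ 2 * Real.log (2 / δ) + 1 :=
    hLdef ▸ (Nat.ceil_lt_add_one (by linarith [Real.log_two_gt_d9])).le
  have hLδ : 2 * ((2 : ℝ) ^ L)⁻¹ ≤ δ := by
    have : 2 / δ ≤ 2 ^ L := by
      rw [← Real.log_le_log_iff (by positivity) (by positivity), Real.log_pow]
      nlinarith [Real.log_two_gt_d9]
    rw [← div_eq_mul_inv, div_le_iff₀ (by positivity)]
    rwa [div_le_iff₀' hδ0] at this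
  have hQ : ∀ x, (newmanPoly L + (newmanPoly L).comp (-Polynomial.X)).eval x
      = (newmanPoly L).eval x + (newmanPoly L).eval (-x) := by simp
  -- The even exponent 2L makes both summands nonnegative on the whole line, and the one with
  -- nonnegative argument is positive.
  have hQpos : ∀ x, 0 < (newmanPoly L).eval x + (newmanPoly L).eval (-x) := by
    intro x
    rcases le_total 0 x with h | h
    · linarith [newmanPoly_eval_pos L h, newmanPoly_eval_nonneg L (-x)]
    · linarith [newmanPoly_eval_pos L (neg_nonneg.2 h), newmanPoly_eval_nonneg L x]
  have hN := newmanPoly_natDegree_le L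
  refine ⟨2 * L * (L + 1) + 1, Polynomial.X * newmanPoly L,
    newmanPoly L + (newmanPoly L).comp (-Polynomial.X), ?_, ?_, ?_, ?_, ?_⟩
  · have h1 : (L : ℝ) ≤ 5.5 * Real.log (1 / δ) := by linarith [Real.log_two_lt_d9]
    have h2 : (L : ℝ) + 1 ≤ 7 * Real.log (1 / δ) := by linarith
    have h3 : (L : ℝ) * (L + 1) ≤ 5.5 * Real.log (1 / δ) * (7 * Real.log (1 / δ)) :=
      mul_le_mul h1 h2 (by positivity) (by linarith)
    push_cast
    nlinarith
  · refine Polynomial.natDegree_mul_le.trans ?_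
    rw [Polynomial.natDegree_X]
    omega
  · refine (Polynomial.natDegree_add_le _ _).trans (max_le (by omega) ?_)
    rw [Polynomial.natDegree_comp, Polynomial.natDegree_neg, Polynomial.natDegree_X]
    omega
  · exact fun x => hQ x ▸ hQpos x
  · intro x hx
    rw [hQ, Polynomial.eval_mul, Polynomial.eval_X]
    have hpos := hQpos x
    have hnn := newmanPoly_eval_nonneg L x
    have hnn' := newmanPoly_eval_nonneg L (-x)
    refine le_trans ?_ hLδ
    rcases le_total 0 x with h | h
    · have e1 := newman_error L h hx.2
      rw [show relu x = x from max_eq_right h]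
      have e2 : x - x * (newmanPoly L).eval x
            / ((newmanPoly L).eval x + (newmanPoly L).eval (-x))
          = x * (newmanPoly L).eval (-x)
            / ((newmanPoly L).eval x + (newmanPoly L).eval (-x)) := by
        field_simp
        ring
      rw [e2, abs_of_nonneg (by positivity)]
      exact e1
    · have e1 := newman_error L (neg_nonneg.2 h) (by linarith [hx.1])
      rw [neg_neg, add_comm] at e1
      rw [show relu x = 0 from max_eq_left h, zero_sub, abs_neg, abs_div, abs_mul,
        abs_of_nonpos h, abs_of_nonneg hnn, abs_of_pos hpos]
      exact e1

end newman

/-! ### Substituting a fraction into a polynomial -/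

section homogenize

variable {d : ℕ}

/-- The polynomial `b ^ r * P (a / b)`. -/
noncomputable def homSubst (r : ℕ) (P : Polynomial ℝ) (a b : MvPolynomial (Fin d) ℝ) :
    MvPolynomial (Fin d) ℝ :=
  ∑ i ∈ Finset.range (r + 1), MvPolynomial.C (P.coeff i) * (a ^ i * b ^ (r - i))

/-- The exponent r need not be the degree of `P`: using one r for numerator and denominator lets the
powers of b cancel in their quotient. -/
theorem eval_homSubst {r : ℕ} {P : Polynomial ℝ} (hP : P.natDegree ≤ r)
    (a b : MvPolynomial (Fin d) ℝ) {x : Fin d → ℝ} (hb : MvPolynomial.eval x b ≠ 0) :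
    MvPolynomial.eval x (homSubst r P a b) = MvPolynomial.eval x b ^ r
      * P.eval (MvPolynomial.eval x a / MvPolynomial.eval x b) := by
  rw [Polynomial.eval_eq_sum_range' (Nat.lt_succ_of_le hP), Finset.mul_sum, homSubst, map_sum]
  refine Finset.sum_congr rfl fun i hi => ?_
  have hir : i ≤ r := Nat.lt_succ_iff.1 (Finset.mem_range.1 hi)
  obtain ⟨j, rfl⟩ := Nat.exists_eq_add_of_le hir
  simp only [map_mul, map_pow, MvPolynomial.eval_C, Nat.add_sub_cancel_left]
  rw [pow_add, div_pow]
  field_simp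

theorem totalDegree_homSubst_le (r : ℕ) (P : Polynomial ℝ) {a b : MvPolynomial (Fin d) ℝ} {E : ℕ}
    (ha : a.totalDegree ≤ E) (hb : b.totalDegree ≤ E) :
    (homSubst r P a b).totalDegree ≤ r * E := by
  refine MvPolynomial.totalDegree_finsetSum_le fun i hi => ?_
  have hir : i ≤ r := Nat.lt_succ_iff.1 (Finset.mem_range.1 hi)
  refine (MvPolynomial.totalDegree_mul _ _).trans ?_
  rw [MvPolynomial.totalDegree_C, zero_add]
  refine (MvPolynomial.totalDegree_mul _ _).trans ?_
  calc _ ≤ i * E + (r - i) * E := add_le_add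
        ((MvPolynomial.totalDegree_pow _ _).trans (Nat.mul_le_mul_left _ ha))
        ((MvPolynomial.totalDegree_pow _ _).trans (Nat.mul_le_mul_left _ hb))
    _ = r * E := by rw [← add_mul, Nat.add_sub_cancel' hir]

end homogenize

/-! ### Normalized networks and their rational approximants -/

namespace ReLUNet

variable {d N : ℕ} {net : ReLUNet d N} {x : Fin d → ℝ}

theorem abs_sum_mul_le {ι : Type*} (s : Finset ι) (w y : ι → ℝ) {B : ℝ}
    (hy : ∀ i ∈ s, w i ≠ 0 → |y i| ≤ B) : |∑ i ∈ s, w i * y i| ≤ (∑ i ∈ s, |w i|) * B := by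
  rw [Finset.sum_mul]
  refine (Finset.abs_sum_le_sum_abs _ _).trans (Finset.sum_le_sum fun i hi => ?_)
  rw [abs_mul]
  rcases eq_or_ne (w i) 0 with h | h
  · simp [h]
  · exact mul_le_mul_of_nonneg_left (hy i hi h) (abs_nonneg _)

/-- The argument of `relu` in node `i`. -/
def preact (net : ReLUNet d N) (x : Fin d → ℝ) (i : Fin N) : ℝ :=
  (∑ l : Fin d, net.inW i l * x l) + (∑ j : Fin N, net.nodeW i j * net.val x j) + net.bias i

/-- Only nodes with an edge into `i` are constrained, so the bound can be used inside the induction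
that proves `val_mem_Icc`. -/
theorem abs_preact_le_of (hnet : net.Normalized) (hx : x ∈ Set.Icc (-1 : Fin d → ℝ) 1) (i : Fin N)
    (h : ∀ j, net.nodeW i j ≠ 0 → |net.val x j| ≤ 1) : |net.preact x i| ≤ 1 := by
  have h1 := abs_sum_mul_le Finset.univ (net.inW i) x (B := 1)
    fun l _ _ => abs_le.2 ⟨hx.1 l, hx.2 l⟩
  have h2 := abs_sum_mul_le Finset.univ (net.nodeW i) (net.val x) (B := 1) fun j _ hj => h j hj
  have h3 := hnet.1 i
  have h4 := abs_add_three (∑ l : Fin d, net.inW i l * x l)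
    (∑ j : Fin N, net.nodeW i j * net.val x j) (net.bias i)
  unfold preact
  linarith

theorem val_mem_Icc (hnet : net.Normalized) (hx : x ∈ Set.Icc (-1 : Fin d → ℝ) 1) (i : Fin N) :
    net.val x i ∈ Set.Icc (0 : ℝ) 1 := by
  induction i using WellFoundedLT.induction with
  | ind i ih =>
    have h := abs_preact_le_of hnet hx i fun j hj => by
      have hji : j < i := by
        by_contra hij
        exact hj (net.acyclic i j (not_lt.1 hij))
      rw [abs_of_nonneg (ih j hji).1]
      exact (ih j hji).2
    rw [val_eq]
    exact ⟨le_max_left _ _, max_le zero_le_one (abs_le.1 h).2⟩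

theorem abs_preact_le (hnet : net.Normalized) (hx : x ∈ Set.Icc (-1 : Fin d → ℝ) 1) (i : Fin N) :
    |net.preact x i| ≤ 1 :=
  abs_preact_le_of hnet hx i fun j _ => by
    have := val_mem_Icc hnet hx j
    rw [abs_of_nonneg this.1]
    exact this.2

/-- A constant always approximates a normalized network up to `1 / 2`. -/
theorem abs_eval_sub_const_le (hnet : net.Normalized) (hx : x ∈ Set.Icc (-1 : Fin d → ℝ) 1) :
    |net.eval x - (net.outB + ∑ i, net.outW i * (1 / 2))| ≤ 1 / 2 := by
  have h1 := abs_sum_mul_le Finset.univ net.outW (fun i => net.val x i - 1 / 2) (B := 1 / 2)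
    fun i _ _ => by
      obtain ⟨h0, h1⟩ := val_mem_Icc hnet hx i
      exact abs_le.2 ⟨by linarith, by linarith⟩
  have h2 := hnet.2
  have h3 : net.eval x - (net.outB + ∑ i, net.outW i * (1 / 2))
      = ∑ i, net.outW i * (net.val x i - 1 / 2) := by
    simp only [eval, mul_sub, Finset.sum_sub_distrib]
    ring
  rw [h3]
  linarith [abs_nonneg net.outB]

end ReLUNet

theorem abs_relu_sub_relu_le (a b : ℝ) : |relu a - relu b| ≤ |a - b| := by
  simpa [relu, max_comm] using abs_max_sub_max_le_abs a b 0

theorem MvPolynomial.totalDegree_finsetProd_le_card_mul {σ ι : Type*} (s : Finset ι)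
    (f : ι → MvPolynomial σ ℝ) {D : ℕ} (h : ∀ i ∈ s, (f i).totalDegree ≤ D) :
    (∏ i ∈ s, f i).totalDegree ≤ s.card * D :=
  (MvPolynomial.totalDegree_finsetProd _ _).trans (Finset.sum_le_card_nsmul _ _ _ h)

namespace ReLUNet

open MvPolynomial

variable {d N k m r : ℕ} {net : ReLUNet d N} {δ : ℝ}

/-- The affine function of node `i`, applied to fractions `Pn j / Q`: the numerator. -/
noncomputable def preactNum (net : ReLUNet d N) (Pn : Fin N → MvPolynomial (Fin d) ℝ)
    (Q : MvPolynomial (Fin d) ℝ) (i : Fin N) : MvPolynomial (Fin d) ℝ :=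
  (∑ l, C (net.inW i l) * (X l * Q)) + (∑ j, C (net.nodeW i j) * Pn j) + C (net.bias i) * Q

theorem totalDegree_preactNum_le {Pn : Fin N → MvPolynomial (Fin d) ℝ}
    {Q : MvPolynomial (Fin d) ℝ} {i : Fin N} {E : ℕ} (hQ : Q.totalDegree + 1 ≤ E)
    (hPn : ∀ j, net.nodeW i j ≠ 0 → (Pn j).totalDegree ≤ E) :
    (net.preactNum Pn Q i).totalDegree ≤ E := by
  have hC : ∀ (c : ℝ) (p : MvPolynomial (Fin d) ℝ), (C c * p).totalDegree ≤ p.totalDegree := by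
    intro c p
    refine (totalDegree_mul _ _).trans ?_
    rw [totalDegree_C, zero_add]
  refine (totalDegree_add _ _).trans (max_le ((totalDegree_add _ _).trans (max_le ?_ ?_)) ?_)
  · refine totalDegree_finsetSum_le fun l _ => (hC _ _).trans ?_
    refine (totalDegree_mul _ _).trans ?_
    rw [totalDegree_X]
    omega
  · refine totalDegree_finsetSum_le fun j _ => ?_
    rcases eq_or_ne (net.nodeW i j) 0 with h | h
    · simp [h]
    · exact (hC _ _).trans (hPn j h)
  · exact (hC _ _).trans (by omega)

/-- The inputs and the bias are reproduced exactly, and the weights of the other nodes have ℓ¹ norm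
at most 1, so an affine step does not amplify the error. -/
theorem abs_preact_sub_le (hnet : net.Normalized) {Pn : Fin N → MvPolynomial (Fin d) ℝ}
    {Q : MvPolynomial (Fin d) ℝ} {i : Fin N} {x : Fin d → ℝ} {e : ℝ} (he : 0 ≤ e)
    (hQ : 0 < MvPolynomial.eval x Q)
    (hPn : ∀ j, net.nodeW i j ≠ 0 → |net.val x j - MvPolynomial.eval x (Pn j) / MvPolynomial.eval x Q| ≤ e) :
    |net.preact x i - MvPolynomial.eval x (net.preactNum Pn Q i) / MvPolynomial.eval x Q| ≤ e := by
  have h1 := abs_sum_mul_le Finset.univ (net.nodeW i)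
    (fun j => net.val x j - MvPolynomial.eval x (Pn j) / MvPolynomial.eval x Q) fun j _ hj => hPn j hj
  have h2 : net.preact x i - MvPolynomial.eval x (net.preactNum Pn Q i) / MvPolynomial.eval x Q
      = ∑ j, net.nodeW i j * (net.val x j - MvPolynomial.eval x (Pn j) / MvPolynomial.eval x Q) := by
    simp only [preact, preactNum, map_add, map_sum, map_mul, eval_C, eval_X, mul_sub,
      Finset.sum_sub_distrib, add_div, Finset.sum_div, mul_div_assoc, div_self hQ.ne', mul_one]
    ring
  rw [h2]
  refine h1.trans (mul_le_of_le_one_left he ?_)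
  have h3 := hnet.1 i
  have h4 : 0 ≤ ∑ l, |net.inW i l| := Finset.sum_nonneg fun _ _ => abs_nonneg _
  linarith [abs_nonneg (net.bias i)]

/-- The nodes of the first `t` layers are approximated by fractions with a common denominator. -/
theorem exists_fractions (hnet : net.Normalized) (layer : Fin N → Fin k)
    (hlayer : ∀ i j : Fin N, net.nodeW i j ≠ 0 → layer j < layer i)
    (hcard : ∀ l : Fin k, (Finset.univ.filter fun i => layer i = l).card ≤ m)
    (hδ0 : 0 ≤ δ) (hkδ : k * δ ≤ 1) {RP RQ : Polynomial ℝ} (hRP : RP.natDegree ≤ r)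
    (hRQ : RQ.natDegree ≤ r) (hRpos : ∀ x, 0 < RQ.eval x)
    (hR : ∀ x ∈ Set.Icc (-2 : ℝ) 2, |relu x - RP.eval x / RQ.eval x| ≤ δ) (t : ℕ) (ht : t ≤ k) :
    ∃ (Q : MvPolynomial (Fin d) ℝ) (Pn : Fin N → MvPolynomial (Fin d) ℝ),
      (∀ x, 0 < MvPolynomial.eval x Q) ∧ Q.totalDegree + 1 ≤ (1 + m * r) ^ t ∧
      ∀ i, (layer i).val < t → (Pn i).totalDegree ≤ (1 + m * r) ^ t ∧
        ∀ x ∈ Set.Icc (-1 : Fin d → ℝ) 1, |net.val x i - MvPolynomial.eval x (Pn i) / MvPolynomial.eval x Q| ≤ t * δ := by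
  induction t with
  | zero => exact ⟨1, 0, by simp, by simp, by simp⟩
  | succ t ih =>
    -- The invariant deg Q + 1 ≤ E leaves room for the products of an input coordinate with `Q` in
    -- `preactNum`.
    obtain ⟨Q, Pn, hQ, hQE, hPn⟩ := ih (by omega)
    set E := (1 + m * r) ^ t with hE
    set T := Finset.univ.filter fun i => layer i = (⟨t, ht⟩ : Fin k) with hT
    have hTm : T.card ≤ m := hcard _
    have hmemT : ∀ {i}, i ∈ T ↔ (layer i).val = t := by
      intro i
      simp [hT, Fin.ext_iff]
    have hprev : ∀ {i j}, i ∈ T → net.nodeW i j ≠ 0 → (layer j).val < t := by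
      intro i j hi hj
      rw [← hmemT.1 hi]
      exact hlayer i j hj
    let a : Fin N → MvPolynomial (Fin d) ℝ := net.preactNum Pn Q
    let Q' : Fin N → MvPolynomial (Fin d) ℝ := fun i => homSubst r RQ (a i) Q
    let P' : Fin N → MvPolynomial (Fin d) ℝ := fun i => homSubst r RP (a i) Q
    have ha : ∀ i ∈ T, (a i).totalDegree ≤ E := fun i hi =>
      totalDegree_preactNum_le hQE fun j hj => (hPn j (hprev hi hj)).1
    have hQ'd : ∀ i ∈ T, (Q' i).totalDegree ≤ r * E := fun i hi =>
      totalDegree_homSubst_le r RQ (ha i hi) (by omega)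
    have hP'd : ∀ i ∈ T, (P' i).totalDegree ≤ r * E := fun i hi =>
      totalDegree_homSubst_le r RP (ha i hi) (by omega)
    have hQ'pos : ∀ i x, 0 < MvPolynomial.eval x (Q' i) := fun i x => by
      simp only [Q']
      rw [eval_homSubst hRQ _ _ (hQ x).ne']
      exact mul_pos (pow_pos (hQ x) _) (hRpos _)
    have hprodpos : ∀ (s : Finset (Fin N)) (x), 0 < MvPolynomial.eval x (∏ i ∈ s, Q' i) := fun s x => by
      rw [map_prod]
      exact Finset.prod_pos fun i _ => hQ'pos i x
    have hE' : (1 + m * r) ^ (t + 1) = E + m * (r * E) := by rw [pow_succ]; ring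
    have hprodd : (∏ i ∈ T, Q' i).totalDegree ≤ m * (r * E) :=
      (totalDegree_finsetProd_le_card_mul T Q' hQ'd).trans (Nat.mul_le_mul_right _ hTm)
    -- The new denominator is `Q` times the denominators of the layer `T`. A fraction from `T` is
    -- expanded by `Q` and the other denominators of `T`, an older one by the whole product.
    refine ⟨Q * ∏ i ∈ T, Q' i, fun i => if i ∈ T then Q * (P' i * ∏ j ∈ T.erase i, Q' j)
      else Pn i * ∏ j ∈ T, Q' j, fun x => ?_, ?_, fun i hi => ?_⟩
    · rw [map_mul]
      exact mul_pos (hQ x) (hprodpos T x)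
    · have := totalDegree_mul Q (∏ i ∈ T, Q' i)
      omega
    · by_cases hiT : i ∈ T
      · simp only [hiT, if_true]
        constructor
        · have h1 := totalDegree_mul Q (P' i * ∏ j ∈ T.erase i, Q' j)
          have h2 := totalDegree_mul (P' i) (∏ j ∈ T.erase i, Q' j)
          have h3 := totalDegree_finsetProd_le_card_mul (T.erase i) Q'
            fun j hj => hQ'd j (Finset.mem_of_mem_erase hj)
          have h4 : r * E + (T.erase i).card * (r * E) ≤ m * (r * E) := by
            rw [← Finset.card_erase_add_one hiT] at hTm
            calc _ = ((T.erase i).card + 1) * (r * E) := by ring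
              _ ≤ _ := Nat.mul_le_mul_right _ hTm
          have h5 := hP'd i hiT
          omega
        · intro x hx
          have htδ : 0 ≤ t * δ := by positivity
          have htk : t * δ ≤ 1 := by
            refine le_trans ?_ hkδ
            have : (t : ℝ) ≤ k := by exact_mod_cast (by omega : t ≤ k)
            gcongr
          have hpre := abs_preact_sub_le (i := i) hnet htδ (hQ x)
            fun j hj => (hPn j (hprev hiT hj)).2 x hx
          have hpre1 := abs_le.1 (abs_preact_le hnet hx i)
          set z := MvPolynomial.eval x (net.preactNum Pn Q i) / MvPolynomial.eval x Q with hz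
          have hval : MvPolynomial.eval x (Q * (P' i * ∏ j ∈ T.erase i, Q' j)) / MvPolynomial.eval x (Q * ∏ i ∈ T, Q' i)
              = RP.eval z / RQ.eval z := by
            rw [← Finset.mul_prod_erase T Q' hiT, ← mul_assoc, ← mul_assoc, map_mul, map_mul,
              map_mul, map_mul, mul_div_mul_right _ _ (hprodpos _ x).ne',
              mul_div_mul_left _ _ (hQ x).ne']
            simp only [P', Q']
            rw [eval_homSubst hRQ _ _ (hQ x).ne', eval_homSubst hRP _ _ (hQ x).ne',
              mul_div_mul_left _ _ (pow_pos (hQ x) _).ne']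
          rw [hval, val_eq]
          -- The exact argument lies in [-1, 1] and the accumulated error is at most k δ ≤ 1; hence
          -- the interval [-2, 2] for the ReLU approximation.
          have hz2 : z ∈ Set.Icc (-2 : ℝ) 2 := by
            have := abs_le.1 hpre
            constructor <;> linarith
          have h1 := hR z hz2
          have h2 := (abs_relu_sub_relu_le (net.preact x i) z).trans hpre
          have h3 := abs_sub_le (relu (net.preact x i)) (relu z) (RP.eval z / RQ.eval z)
          push_cast
          change |relu (net.preact x i) - _| ≤ _
          linarith
      · have hit : (layer i).val < t := by
          have : (layer i).val ≠ t := fun h => hiT (hmemT.2 h)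
          omega
        obtain ⟨hd, herr⟩ := hPn i hit
        simp only [hiT, if_false]
        constructor
        · have := totalDegree_mul (Pn i) (∏ j ∈ T, Q' j)
          omega
        · intro x hx
          rw [map_mul, map_mul, mul_div_mul_right _ _ (hprodpos T x).ne']
          refine (herr x hx).trans ?_
          push_cast
          linarith

end ReLUNet

/-- Rational functions approximate ReLU networks. -/
theorem rational_approximates_relu : ∃ C : ℝ, 0 < C ∧
      ∀ (ε : ℝ), 0 < ε → ε ≤ 1 → ∀ (k m d N : ℕ) (net : ReLUNet d N),
        net.HasLayers k m → net.Normalized →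
        ∃ P Q : MvPolynomial (Fin d) ℝ,
          (∀ x : Fin d → ℝ, 0 < MvPolynomial.eval x Q) ∧
          ((max P.totalDegree Q.totalDegree : ℕ) : ℝ) ≤
            (C * m * Real.log (k / ε) ^ 2) ^ k ∧
          ∀ x ∈ Set.Icc (-1 : Fin d → ℝ) 1,
            |net.eval x - MvPolynomial.eval x P / MvPolynomial.eval x Q| ≤ ε := by
  refine ⟨83, by norm_num, fun ε hε0 hε1 k m d N net hlayers hnet => ?_⟩
  have hconst : ∀ c : ℝ, (∀ x ∈ Set.Icc (-1 : Fin d → ℝ) 1, |net.eval x - c| ≤ ε) →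
      ∃ P Q : MvPolynomial (Fin d) ℝ, (∀ x : Fin d → ℝ, 0 < MvPolynomial.eval x Q) ∧
        ((max P.totalDegree Q.totalDegree : ℕ) : ℝ) ≤ (83 * m * Real.log (k / ε) ^ 2) ^ k ∧
        ∀ x ∈ Set.Icc (-1 : Fin d → ℝ) 1,
          |net.eval x - MvPolynomial.eval x P / MvPolynomial.eval x Q| ≤ ε := by
    intro c hc
    refine ⟨MvPolynomial.C c, 1, by simp, ?_, by simpa using hc⟩
    simp only [MvPolynomial.totalDegree_C, MvPolynomial.totalDegree_one, max_self, Nat.cast_zero]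
    positivity
  -- For k = 1 and ε = 1 the logarithm vanishes and only constants are allowed. For ε < 1/2 and k ≥
  -- 1 it is at least ln 2.
  rcases le_or_gt (1 / 2) ε with hε | hε
  · exact hconst _ fun x hx => (ReLUNet.abs_eval_sub_const_le hnet hx).trans hε
  obtain ⟨layer, hlayer, hcard⟩ := hlayers
  rcases Nat.eq_zero_or_pos N with rfl | hN
  · exact hconst net.outB fun x _ => by simp [ReLUNet.eval, hε0.le]
  have hk : 1 ≤ k := by
    have := (layer ⟨0, hN⟩).isLt
    omega
  have hm : 1 ≤ m := by
    refine le_trans (Finset.card_pos.2 ⟨⟨0, hN⟩, ?_⟩) (hcard (layer ⟨0, hN⟩))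
    simp
  have hk1 : (1 : ℝ) ≤ k := by exact_mod_cast hk
  have hm1 : (1 : ℝ) ≤ m := by exact_mod_cast hm
  have hδ0 : 0 < ε / k := by positivity
  have hkδ : k * (ε / k) = ε := mul_div_cancel₀ ε (by positivity)
  have hδ : ε / k ≤ 1 / 2 := (div_le_self hε0.le hk1).trans hε.le
  obtain ⟨r, RP, RQ, hr, hRP, hRQ, hRpos, hR⟩ := exists_rational_approx_relu hδ0 hδ
  rw [one_div_div] at hr
  have hlam : 0.69 ≤ Real.log (k / ε) := by
    have : Real.log 2 ≤ Real.log (k / ε) :=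
      Real.log_le_log (by norm_num) (by rw [le_div_iff₀ hε0]; linarith)
    linarith [Real.log_two_gt_d9]
  obtain ⟨Q, Pn, hQ, hQd, hPn⟩ := ReLUNet.exists_fractions hnet layer hlayer hcard hδ0.le
    (by rw [hkδ]; exact hε1) hRP hRQ hRpos hR k le_rfl
  refine ⟨(∑ i, MvPolynomial.C (net.outW i) * Pn i) + MvPolynomial.C net.outB * Q, Q, hQ, ?_,
    fun x hx => ?_⟩
  · have hC : ∀ (c : ℝ) (p : MvPolynomial (Fin d) ℝ),
        (MvPolynomial.C c * p).totalDegree ≤ p.totalDegree := by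
      intro c p
      refine (MvPolynomial.totalDegree_mul _ _).trans ?_
      rw [MvPolynomial.totalDegree_C, zero_add]
    have hdeg : max ((∑ i, MvPolynomial.C (net.outW i) * Pn i)
        + MvPolynomial.C net.outB * Q).totalDegree Q.totalDegree ≤ (1 + m * r) ^ k := by
      refine max_le ((MvPolynomial.totalDegree_add _ _).trans (max_le ?_ ?_)) (by omega)
      · exact MvPolynomial.totalDegree_finsetSum_le fun i _ =>
          (hC _ _).trans (hPn i (layer i).isLt).1
      · exact (hC _ _).trans (by omega)
    calc _ ≤ (((1 + m * r) ^ k : ℕ) : ℝ) := by exact_mod_cast hdeg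
      _ = (1 + m * r : ℝ) ^ k := by push_cast; rfl
      _ ≤ _ := by
        refine pow_le_pow_left₀ (by positivity) ?_ k
        -- Absorbs the 1 of 1 + m r; the constant is 83 = 3 + 80.
        have h1 : (1 : ℝ) ≤ 3 * Real.log (k / ε) ^ 2 := by nlinarith
        calc (1 + m * r : ℝ) ≤ m * (3 * Real.log (k / ε) ^ 2)
              + m * (80 * Real.log (k / ε) ^ 2) := by
              gcongr
              exact one_le_mul_of_one_le_of_one_le hm1 h1
          _ = _ := by ring
  · have h1 := ReLUNet.abs_sum_mul_le Finset.univ net.outW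
      (fun i => net.val x i - MvPolynomial.eval x (Pn i) / MvPolynomial.eval x Q)
      fun i _ _ => (hPn i (layer i).isLt).2 x hx
    have h2 : net.eval x - MvPolynomial.eval x ((∑ i, MvPolynomial.C (net.outW i) * Pn i)
          + MvPolynomial.C net.outB * Q) / MvPolynomial.eval x Q
        = ∑ i, net.outW i
          * (net.val x i - MvPolynomial.eval x (Pn i) / MvPolynomial.eval x Q) := by
      simp only [ReLUNet.eval, map_add, map_sum, map_mul, MvPolynomial.eval_C, mul_sub,
        Finset.sum_sub_distrib, add_div, Finset.sum_div, mul_div_assoc, div_self (hQ x).ne',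
        mul_one]
      ring
    rw [h2]
    rw [hkδ] at h1
    refine h1.trans (mul_le_of_le_one_left hε0.le ?_)
    linarith [hnet.2, abs_nonneg net.outB]

theorem theorem1 :
    -- Part 1: ReLU networks approximate rational functions.
    (∃ C : ℝ, 0 < C ∧
      ∀ (ε : ℝ), 0 < ε → ε ≤ 1 → ∀ (k d r s : ℕ) (A : ℝ), 1 ≤ A →
      ∀ (p q : MvPolynomial (Fin d) ℝ),
        p.totalDegree ≤ r → q.totalDegree ≤ r →
        p.support.card ≤ s → q.support.card ≤ s →
        (∀ α : Fin d →₀ ℕ, |p.coeff α| ≤ A) → (∀ α : Fin d →₀ ℕ, |q.coeff α| ≤ A) →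
        (∀ x ∈ Set.Icc (0 : Fin d → ℝ) 1, MvPolynomial.eval x p ∈ Set.Icc (-1 : ℝ) 1) →
        (∀ x ∈ Set.Icc (0 : Fin d → ℝ) 1,
          MvPolynomial.eval x q ∈ Set.Icc (((2 : ℝ) ^ k)⁻¹) 1) →
        ∃ (N : ℕ) (net : ReLUNet d N),
          (net.size : ℝ) ≤
            C * (((k : ℝ) + 1) ^ 7 * Real.log (2 / ε) ^ 3
              + min ((s : ℝ) * r * ((k : ℝ) + 1) * Real.log (A * s * r / ε))
                  ((s : ℝ) * d * ((k : ℝ) + 1) ^ 2 * Real.log (A * d * s * r / ε) ^ 2)) ∧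
          ∀ x ∈ Set.Icc (0 : Fin d → ℝ) 1,
            |net.eval x - MvPolynomial.eval x p / MvPolynomial.eval x q| ≤ ε) ∧
    -- Part 2: rational functions approximate ReLU networks.
    (∃ C : ℝ, 0 < C ∧
      ∀ (ε : ℝ), 0 < ε → ε ≤ 1 → ∀ (k m d N : ℕ) (net : ReLUNet d N),
        net.HasLayers k m → net.Normalized →
        ∃ P Q : MvPolynomial (Fin d) ℝ,
          (∀ x : Fin d → ℝ, 0 < MvPolynomial.eval x Q) ∧
          ((max P.totalDegree Q.totalDegree : ℕ) : ℝ) ≤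
            (C * m * Real.log (k / ε) ^ 2) ^ k ∧
          ∀ x ∈ Set.Icc (-1 : Fin d → ℝ) 1,
            |net.eval x - MvPolynomial.eval x P / MvPolynomial.eval x Q| ≤ ε) := by
  exact ⟨relu_approximates_rational, rational_approximates_relu⟩
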